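/- Let $\nu<\frac16$ and $s\ge 1$ be real numbers. Then the initial value problem for the third-order KdV–BBM equation $$u_t+u_x+\tfrac32\,uu_x+\nu u_{xxx}-\left(\tfrac16-\nu\right)u_{xxt}=0,\qquad x\in\mathbb{R},\ t\ge 0,\qquad u(\cdot,0)=u_0,$$ is globally well-posed in the Sobolev space $H^s(\mathbb{R})$ of real-valued functions. That is: 1. (Existence) For every $u_0\in H^s(\mathbb{R})$ there is a solution $u\in C([0,\infty);H^s(\mathbb{R}))$ with $u(0)=u_0$. 2. (Uniqueness) For every $T>0$, any solution $v\in C([0,T];H^s(\mathbb{R}))$ with $v(0)=u_0$ coincides with $u$ on $[0,T]$. 3. (Continuous dependence) For every $T>0$, the map $u_0\mapsto u|_{[0,T]}$ is continuous from $H^s(\mathbb{R})$ to $C([0,T];H^s(\mathbb{R}))$ with the supremum norm. Here $u\in C(I;H^s(\mathbb{R}))$ is a solution on the time interval $I$ if the equation holds in the sense of distributions in $x$ at every time: for every $\chi\in C_c^\infty(\mathbb{R})$ and every $t\in I$, $$\frac{d}{dt}\int_{\mathbb{R}}u\left(\chi-\left(\tfrac16-\nu\right)\chi''\right)dx=\int_{\mathbb{R}}u\left(\chi'+\nu\chi'''\right)dx+\frac34\int_{\mathbb{R}}u^2\chi'\,dx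 ,$$ with one-sided time derivatives at the end points of $I$. -/

import Mathlib

open MeasureTheory Topology FourierTransform Set
open scoped ContDiff

namespace KdVBBM

/-! ### The Sobolev spaces `H^s(ℝ)` of real-valued functions -/

/-- The `L²` Fourier transform of a real-valued `L²` function on the line
(normalised as `û(ξ) = ∫ u(x) exp(-2πi x ξ) dx`, which makes it an isometry of `L²`). -/
noncomputable def fourierL2 (u : Lp ℝ 2 (volume : Measure ℝ)) : Lp ℂ 2 (volume : Measure ℝ) :=
  𝓕 (Complex.ofRealCLM.compLp u : Lp ℂ 2 (volume : Measure ℝ))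

/-- The weight `(1 + (2πξ)²)^{s/2}`. With the normalisation above, `2πξ` is the symbol of `-i∂ₓ`,
so this is the symbol of `(1 - ∂ₓ²)^{s/2}`. -/
noncomputable def sobolevWeight (s : ℝ) (ξ : ℝ) : ℝ :=
  (1 + (2 * Real.pi * ξ) ^ 2) ^ (s / 2)

lemma sobolevWeight_pos (s ξ : ℝ) : 0 < sobolevWeight s ξ :=
  Real.rpow_pos_of_pos (by positivity) _

/-- The function `ξ ↦ (1 + (2πξ)²)^{s/2} û(ξ)`, the Fourier transform of `(1 - ∂ₓ²)^{s/2} u`. -/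
noncomputable def weightedFourier (s : ℝ) (u : Lp ℝ 2 (volume : Measure ℝ)) (ξ : ℝ) : ℂ :=
  (sobolevWeight s ξ : ℂ) * fourierL2 u ξ

lemma fourierL2_add (u v : Lp ℝ 2 (volume : Measure ℝ)) :
    fourierL2 (u + v) = fourierL2 u + fourierL2 v := by
  have h := map_add (Complex.ofRealCLM.compLpₗ 2 (volume : Measure ℝ)) u v
  simp only [ContinuousLinearMap.compLpₗ_apply] at h
  simp only [fourierL2, h, FourierTransform.fourier_add]

lemma fourierL2_smul (c : ℝ) (u : Lp ℝ 2 (volume : Measure ℝ)) :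
    fourierL2 (c • u) = (c : ℂ) • fourierL2 u := by
  have h := map_smul (Complex.ofRealCLM.compLpₗ 2 (volume : Measure ℝ)) c u
  simp only [ContinuousLinearMap.compLpₗ_apply] at h
  have h2 : c • (Complex.ofRealCLM.compLp u) = (c : ℂ) • (Complex.ofRealCLM.compLp u) := by
    ext1
    filter_upwards [Lp.coeFn_smul c (Complex.ofRealCLM.compLp u),
      Lp.coeFn_smul (c : ℂ) (Complex.ofRealCLM.compLp u)] with x h1 h2
    rw [h1, h2, Pi.smul_apply, Pi.smul_apply, Complex.real_smul, smul_eq_mul]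
  simp only [fourierL2, h, h2, FourierTransform.fourier_smul]

lemma fourierL2_eq_zero {u : Lp ℝ 2 (volume : Measure ℝ)} (h : fourierL2 u = 0) : u = 0 := by
  have h0 : ‖(Complex.ofRealCLM.compLp u : Lp ℂ 2 (volume : Measure ℝ))‖ = 0 := by
    rw [← MeasureTheory.Lp.norm_fourier_eq]
    change ‖fourierL2 u‖ = 0
    rw [h, norm_zero]
  have h1 := norm_eq_zero.mp h0
  ext1
  have h2 := Complex.ofRealCLM.coeFn_compLp u
  rw [h1] at h2
  filter_upwards [h2, Lp.coeFn_zero ℂ 2 (volume : Measure ℝ),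
    Lp.coeFn_zero ℝ 2 (volume : Measure ℝ)] with x ha hb hc
  rw [hb] at ha
  rw [hc]
  simpa using ha.symm

lemma weightedFourier_add (s : ℝ) (u v : Lp ℝ 2 (volume : Measure ℝ)) :
    weightedFourier s (u + v) =ᵐ[volume] weightedFourier s u + weightedFourier s v := by
  filter_upwards [Lp.coeFn_add (fourierL2 u) (fourierL2 v)] with ξ h
  simp only [weightedFourier, fourierL2_add, Pi.add_apply, h]
  ring

lemma weightedFourier_smul (s c : ℝ) (u : Lp ℝ 2 (volume : Measure ℝ)) :
    weightedFourier s (c • u) =ᵐ[volume] c • weightedFourier s u := by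
  filter_upwards [Lp.coeFn_smul (c : ℂ) (fourierL2 u)] with ξ h
  simp only [weightedFourier, fourierL2_smul, Pi.smul_apply, h, Complex.real_smul, smul_eq_mul]
  ring

/-- The real-valued `u ∈ L²(ℝ)` for which `(1 + (2πξ)²)^{s/2} û(ξ)` is square integrable. -/
noncomputable def sobolevSubmodule (s : ℝ) : Submodule ℝ (Lp ℝ 2 (volume : Measure ℝ)) where
  carrier := {u | MemLp (weightedFourier s u) 2 volume}
  add_mem' {u v} hu hv := by
    simp only [mem_ofPred_eq] at *
    exact (memLp_congr_ae (weightedFourier_add s u v)).mpr (hu.add hv)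
  zero_mem' := by
    have h := weightedFourier_smul s 0 0
    rw [smul_zero, zero_smul] at h
    simp only [mem_ofPred_eq]
    exact (memLp_congr_ae h).mpr MemLp.zero
  smul_mem' c u hu := by
    simp only [mem_ofPred_eq] at *
    exact (memLp_congr_ae (weightedFourier_smul s c u)).mpr (hu.const_smul c)

/-- The linear map `u ↦ (1 + (2πξ)²)^{s/2} û` from `H^s(ℝ)` into `L²(ℝ; ℂ)`. -/
noncomputable def weightedFourierL2 (s : ℝ) :
    sobolevSubmodule s →ₗ[ℝ] Lp ℂ 2 (volume : Measure ℝ) where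
  toFun u := MemLp.toLp (weightedFourier s u.1) u.2
  map_add' u v :=
    (MemLp.toLp_congr (u + v).2 (MemLp.add u.2 v.2) (weightedFourier_add s u.1 v.1)).trans
      (MemLp.toLp_add u.2 v.2)
  map_smul' c u :=
    (MemLp.toLp_congr (c • u).2 (MemLp.const_smul u.2 c) (weightedFourier_smul s c u.1)).trans
      (MemLp.toLp_const_smul c u.2)

lemma weightedFourierL2_injective (s : ℝ) : Function.Injective (weightedFourierL2 s) := by
  rw [injective_iff_map_eq_zero]
  intro u hu
  apply Subtype.ext
  apply fourierL2_eq_zero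
  ext1
  have h1 : weightedFourierL2 s u =ᵐ[volume] weightedFourier s u.1 := MemLp.coeFn_toLp u.2
  rw [hu] at h1
  filter_upwards [h1, Lp.coeFn_zero ℂ 2 (volume : Measure ℝ)] with ξ ha hb
  rw [hb] at ha ⊢
  have hw : (sobolevWeight s ξ : ℂ) ≠ 0 := by exact_mod_cast (sobolevWeight_pos s ξ).ne'
  simpa [weightedFourier, hw] using ha.symm

/-- Membership in this subspace, for `s ≥ 0`, agrees with Mathlib's notion of a Sobolev
(Bessel potential) distribution. -/
theorem mem_sobolevSubmodule_iff_memSobolev {s : ℝ} (hs : 0 ≤ s)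
    (u : Lp ℝ 2 (volume : Measure ℝ)) :
    u ∈ sobolevSubmodule s ↔ TemperedDistribution.MemSobolev s 2
      (Lp.toTemperedDistribution (Complex.ofRealCLM.compLp u : Lp ℂ 2 (volume : Measure ℝ))) := by
  set m : ℝ → ℝ → ℂ := fun r ξ => (((1 + ‖ξ‖ ^ 2) ^ (r / 2) : ℝ) : ℂ) with hm
  have hmt : ∀ r, (m r).HasTemperateGrowth := fun r => by simp only [hm]; fun_prop
  have hmp : ∀ r ξ, m r ξ * m (-r) ξ = 1 := fun r ξ => by
    simp only [hm]
    rw [← Complex.ofReal_mul, ← Real.rpow_add (by positivity)]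
    norm_num [← add_div]
  have hnorm : ∀ r ξ, ‖m r ξ‖ = (1 + ‖ξ‖ ^ 2) ^ (r / 2) := fun r ξ => by
    simp only [hm, Complex.norm_real, Real.norm_eq_abs]
    exact abs_of_pos (by positivity)
  have hbd : MemLp (m (-s)) ⊤ (volume : Measure ℝ) := by
    refine memLp_top_of_bound (hmt (-s)).1.continuous.aestronglyMeasurable 1 (.of_forall fun ξ => ?_)
    rw [hnorm]
    exact Real.rpow_le_one_of_one_le_of_nonpos (by simpa using sq_nonneg ξ) (by linarith)
  -- the two weights are comparable
  have hpi := Real.pi_gt_three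
  have hcomp : u ∈ sobolevSubmodule s ↔ MemLp (fun ξ => m s ξ * fourierL2 u ξ) 2 volume := by
    change MemLp (weightedFourier s u) 2 volume ↔ _
    have hmeas1 : AEStronglyMeasurable (weightedFourier s u) volume := by
      refine AEStronglyMeasurable.mul ?_ (Lp.aestronglyMeasurable _)
      refine Continuous.aestronglyMeasurable (Complex.continuous_ofReal.comp ?_)
      exact Continuous.rpow_const (by fun_prop) fun ξ => Or.inl (by positivity)
    have hmeas2 : AEStronglyMeasurable (fun ξ => m s ξ * fourierL2 u ξ) volume :=
      (hmt s).1.continuous.aestronglyMeasurable.mul (Lp.aestronglyMeasurable _)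
    have hw : ∀ ξ, ‖weightedFourier s u ξ‖ = sobolevWeight s ξ * ‖fourierL2 u ξ‖ := fun ξ => by
      rw [weightedFourier, norm_mul, Complex.norm_real, Real.norm_eq_abs,
        abs_of_pos (sobolevWeight_pos s ξ)]
    constructor
    · intro h
      refine h.mono hmeas2 (.of_forall fun ξ => ?_)
      rw [norm_mul, hnorm, hw]
      refine mul_le_mul_of_nonneg_right ?_ (norm_nonneg _)
      refine Real.rpow_le_rpow (by positivity) ?_ (by positivity)
      rw [Real.norm_eq_abs, sq_abs, mul_pow]
      nlinarith [sq_nonneg ξ, mul_nonneg (sq_nonneg ξ) (sq_nonneg (Real.pi - 1))]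
    · intro h
      refine h.of_le_mul (c := ((2 * Real.pi) ^ 2) ^ (s / 2)) hmeas1 (.of_forall fun ξ => ?_)
      rw [norm_mul, hnorm, hw, ← mul_assoc, ← Real.mul_rpow (by positivity) (by positivity)]
      refine mul_le_mul_of_nonneg_right ?_ (norm_nonneg _)
      refine Real.rpow_le_rpow (by positivity) ?_ (by positivity)
      rw [Real.norm_eq_abs, sq_abs, mul_pow]
      nlinarith [sq_nonneg ξ]
  rw [hcomp, TemperedDistribution.memSobolev_iff_exists_smulLeftCLM_fourier,
    Lp.fourier_toTemperedDistribution_eq]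
  change _ ↔ ∃ f' : Lp ℂ 2 (volume : Measure ℝ),
    TemperedDistribution.smulLeftCLM ℂ (m s) (fourierL2 u : TemperedDistribution ℝ ℂ) = f'
  have hcancel : ∀ r : ℝ, m r * m (-r) = fun _ => (1 : ℂ) := fun r => funext (hmp r)
  have hsm : ∀ f : Lp ℂ 2 (volume : Measure ℝ),
      ((hbd.toLp _ • f : Lp ℂ 2 (volume : Measure ℝ)) : TemperedDistribution ℝ ℂ) =
        TemperedDistribution.smulLeftCLM ℂ (m (-s)) f := fun f =>
    Lp.toTemperedDistribution_smul_eq (hmt _) hbd f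
  constructor
  · intro h
    refine ⟨h.toLp _, ?_⟩
    set f : Lp ℂ 2 (volume : Measure ℝ) := h.toLp _ with hf
    have h3 : f =ᵐ[volume] fun ξ => m s ξ * fourierL2 u ξ := h.coeFn_toLp
    clear_value f
    have h1 : fourierL2 u = hbd.toLp _ • f := by
      ext1
      filter_upwards [Lp.coeFn_lpSMul (r := 2) (hbd.toLp _) f, hbd.coeFn_toLp,
        h3] with ξ h1 h2 h3
      rw [h1, Pi.smul_apply', h2, h3, smul_eq_mul, ← mul_assoc, mul_comm (m (-s) ξ), hmp, one_mul]
    rw [h1, hsm, TemperedDistribution.smulLeftCLM_smulLeftCLM_apply (hmt _) (hmt _), mul_comm,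
      hcancel, TemperedDistribution.smulLeftCLM_const, one_smul]
  · rintro ⟨f, hf⟩
    have h1 : fourierL2 u = hbd.toLp _ • f := by
      have hinj : Function.Injective (Lp.toTemperedDistributionCLM ℂ (volume : Measure ℝ) 2) :=
        LinearMap.ker_eq_bot.mp Lp.ker_toTemperedDistributionCLM_eq_bot
      apply hinj
      rw [Lp.toTemperedDistributionCLM_apply, Lp.toTemperedDistributionCLM_apply, hsm, ← hf,
        TemperedDistribution.smulLeftCLM_smulLeftCLM_apply (hmt _) (hmt _),
        hcancel, TemperedDistribution.smulLeftCLM_const, one_smul]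
    refine (memLp_congr_ae ?_).mpr (Lp.memLp f)
    rw [h1]
    filter_upwards [Lp.coeFn_lpSMul (r := 2) (hbd.toLp _) f, hbd.coeFn_toLp] with ξ h1 h2
    rw [h1, Pi.smul_apply', h2, smul_eq_mul, ← mul_assoc, hmp, one_mul]

/-- The Sobolev space `H^s(ℝ) = H^s(ℝ; ℝ)` for `s ≥ 0`. It is a type of its own, so that it carries
the `H^s` norm defined below and not the `L²` norm. -/
def Sobolev (s : ℝ) : Type := sobolevSubmodule s

noncomputable instance (s : ℝ) : AddCommGroup (Sobolev s) :=
  inferInstanceAs (AddCommGroup (sobolevSubmodule s))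

noncomputable instance (s : ℝ) : Module ℝ (Sobolev s) :=
  inferInstanceAs (Module ℝ (sobolevSubmodule s))

/-- The inclusion `H^s(ℝ) → L²(ℝ)`. -/
noncomputable def Sobolev.toL2 {s : ℝ} : Sobolev s →ₗ[ℝ] Lp ℝ 2 (volume : Measure ℝ) :=
  (sobolevSubmodule s).subtype

/-- The norm of `H^s(ℝ)` is `‖u‖_{H^s} = (∫ (1 + (2πξ)²)^s |û(ξ)|² dξ)^{1/2}`. -/
noncomputable instance (s : ℝ) : NormedAddCommGroup (Sobolev s) :=
  NormedAddCommGroup.induced (Sobolev s) (Lp ℂ 2 (volume : Measure ℝ))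
    (weightedFourierL2 s) (weightedFourierL2_injective s)

lemma Sobolev.norm_def {s : ℝ} (u : Sobolev s) : ‖u‖ = ‖weightedFourierL2 s u‖ := rfl

/-! ### The third-order KdV–BBM equation -/

/-- `u : ℝ → H^s(ℝ)`, regarded on the time interval `I`, belongs to `C(I; H^s(ℝ))` and solves
`u_t + u_x + (3/2) u u_x + ν u_xxx - (1/6 - ν) u_xxt = 0` on `I`. At every time `t ∈ I` the equation
holds in the sense of distributions in `x`: for every test function `χ ∈ C_c^∞(ℝ)`,
`d/dt ∫ u (χ - (1/6 - ν) χ'') dx = ∫ u (χ' + ν χ''') dx + (3/4) ∫ u² χ' dx`,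
with one-sided time derivatives at the end points of `I`. -/
structure IsSolutionOn (ν s : ℝ) (I : Set ℝ) (u : ℝ → Sobolev s) : Prop where
  continuousOn : ContinuousOn u I
  equation : ∀ χ : ℝ → ℝ, ContDiff ℝ ∞ χ → HasCompactSupport χ → ∀ t ∈ I,
    HasDerivWithinAt
      (fun τ => ∫ x, (u τ).toL2 x * (χ x - (1 / 6 - ν) * iteratedDeriv 2 χ x))
      ((∫ x, (u t).toL2 x * (deriv χ x + ν * iteratedDeriv 3 χ x))
        + 3 / 4 * ∫ x, ((u t).toL2 x) ^ 2 * deriv χ x)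
      I t

/-- Global well-posedness in `H^s(ℝ)` of the initial value problem
`u_t + u_x + (3/2) u u_x + ν u_xxx - (1/6 - ν) u_xxt = 0`, `u(·, 0) = u₀`, in the sense of Hadamard.
There is a data-to-solution map `Φ` with the following properties. -/
def GloballyWellPosed (ν s : ℝ) : Prop :=
  ∃ Φ : Sobolev s → ℝ → Sobolev s,
    -- existence of a solution in `C([0, ∞); H^s)` for every initial datum in `H^s`
    (∀ u₀, IsSolutionOn ν s (Ici 0) (Φ u₀) ∧ Φ u₀ 0 = u₀) ∧
    -- uniqueness in `C([0, T]; H^s)` for every `T > 0`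
    (∀ u₀, ∀ T > 0, ∀ v : ℝ → Sobolev s, IsSolutionOn ν s (Icc 0 T) v → v 0 = u₀ →
      EqOn v (Φ u₀) (Icc 0 T)) ∧
    -- continuity of the data-to-solution map from `H^s` to `C([0, T]; H^s)` for every `T > 0`
    (∀ u₀, ∀ T > 0, TendstoUniformlyOn Φ (Φ u₀) (𝓝 u₀) (Icc 0 T))

end KdVBBM

/-! Put γ = 1/6 - ν > 0 and κ = 2πξ. After inverting 1 - γ∂ₓ², the equation reads û_t = iλ û + m (û
* û) on the Fourier side, with λ = (-κ + νκ³)/(1 + γκ²) real and m = -(3/4) iκ/(1 + γκ²). The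
nonlinear term gains a derivative, but λ grows linearly when ν ≠ 0, so the linear term is not a
bounded operator on H^s. Let w_s = (1 + κ²)^{s/2}. In the interaction picture a = exp(-itλ) w_s û
the linear term disappears, and a' = `field` t a is an ordinary differential equation with a locally
Lipschitz field on a Hilbert space. Since exp(itλ) is isometric, bounds on a are bounds on u in H^s.

Global existence rests on two facts, packaged in `TameField`. The energy ∫ u² + γ u_x² is conserved
(`inner_energyRatio_bilin_eq_zero`), which comes down to ∫ u ∂ₓ(u²) = 0. The field is also tame
(`exists_norm_bilin_le`): it is bounded by the energy norm times the H^s norm. Indeed, with e = (1 +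
γκ²)^{1/2}, the weight w_s m of the product is dominated by the sum of w_s/e over the two
frequencies, and the factor without weight has its transform in L¹ because 1/e is in L². So ‖a‖
grows at most exponentially, and `TameField.exists_trajectory` reaches any time T. Grönwall for two
trajectories gives continuous dependence.

Uniqueness is among all weak solutions. The functions χ - γχ'' are rich enough to recover û_t as an
L² derivative (`eq_zero_of_inner_testPsi_eq_zero`, `IsSolutionOn.hasDerivWithinAt`). In L² the
linear term is skew, and Grönwall for the L² distance concludes (`IsSolutionOn.eqOn`). Conversely, a
trajectory yields a weak solution by moving the group onto the test function
(`isSolutionOn_of_trajectory`). -/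

open scoped NNReal ENNReal SchwartzMap

namespace KdVBBM

/-! ### Ordinary differential equations with a conserved quadratic form -/

section AbstractODE

variable {E G : Type*} [NormedAddCommGroup E] [NormedSpace ℝ E]
  [NormedAddCommGroup G] [InnerProductSpace ℝ G]

/-- A time-dependent vector field, quadratically growing and locally Lipschitz, with a conserved
quadratic form `‖A x‖²` that controls its growth. -/
structure TameField (M : ℝ → E → E) (A : E →L[ℝ] G) (K C : ℝ) : Prop where
  nonneg_lip : 0 ≤ K
  nonneg_tame : 0 ≤ C
  continuous_time : ∀ x, Continuous fun t => M t x
  map_zero : ∀ t, M t 0 = 0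
  norm_sub_le : ∀ t x y, ‖M t x - M t y‖ ≤ K * (‖x‖ + ‖y‖) * ‖x - y‖
  norm_le : ∀ t x, ‖M t x‖ ≤ C * ‖A x‖ * ‖x‖
  inner_eq_zero : ∀ t x, inner ℝ (A x) (A (M t x)) = 0

/-- A cut-off function, equal to `1` for `r ≤ R` and to `0` for `2 * R ≤ r`. -/
noncomputable def cutoff (R r : ℝ) : ℝ := max 0 (min 1 (2 - r / R))

lemma cutoff_nonneg (R r : ℝ) : 0 ≤ cutoff R r := le_max_left _ _

lemma cutoff_le_one (R r : ℝ) : cutoff R r ≤ 1 := max_le zero_le_one (min_le_left _ _)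

lemma cutoff_eq_one {R r : ℝ} (hR : 0 < R) (h : r ≤ R) : cutoff R r = 1 := by
  have : r / R ≤ 1 := (div_le_one hR).2 h
  rw [cutoff, min_eq_left (by linarith), max_eq_right zero_le_one]

lemma cutoff_eq_zero {R r : ℝ} (hR : 0 < R) (h : 2 * R ≤ r) : cutoff R r = 0 := by
  have : 2 ≤ r / R := (le_div_iff₀ hR).2 h
  exact max_eq_left ((min_le_right _ _).trans (by linarith))

lemma abs_cutoff_sub_le {R : ℝ} (hR : 0 < R) (r r' : ℝ) :
    |cutoff R r - cutoff R r'| ≤ |r - r'| / R := by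
  have h1 := abs_max_sub_max_le_max 0 (min 1 (2 - r / R)) 0 (min 1 (2 - r' / R))
  have h2 := abs_min_sub_min_le_max 1 (2 - r / R) 1 (2 - r' / R)
  rw [sub_self, abs_zero, max_eq_right (abs_nonneg (_ - _))] at h2
  rw [sub_self, abs_zero, max_eq_right (a := (0 : ℝ)) (abs_nonneg (_ - _))] at h1
  refine (h1.trans h2).trans_eq ?_
  rw [show 2 - r / R - (2 - r' / R) = -((r - r') / R) by ring, abs_neg, abs_div, abs_of_pos hR]

/-- On the ball of radius 2R the field has Lipschitz constant 4KR. The cut-off has slope 1/R and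
multiplies a vector of norm at most K(2R)², which costs another 4KR. Outside that ball the truncated
field vanishes. -/
lemma norm_cutoff_smul_sub_le {M : E → E} {K R : ℝ} (hK : 0 ≤ K) (hR : 0 < R)
    (h0 : M 0 = 0) (hM : ∀ x y, ‖M x - M y‖ ≤ K * (‖x‖ + ‖y‖) * ‖x - y‖) (x y : E) :
    ‖cutoff R ‖x‖ • M x - cutoff R ‖y‖ • M y‖ ≤ 8 * K * R * ‖x - y‖ := by
  have hMx : ∀ x, ‖M x‖ ≤ K * ‖x‖ * ‖x‖ := fun x => by simpa [h0] using hM x 0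
  have key : ∀ x y : E, ‖x‖ ≤ 2 * R →
      ‖cutoff R ‖x‖ • M x - cutoff R ‖y‖ • M y‖ ≤ 8 * K * R * ‖x - y‖ := by
    intro x y hx
    have e : cutoff R ‖x‖ • M x - cutoff R ‖y‖ • M y
        = (cutoff R ‖x‖ - cutoff R ‖y‖) • M x + cutoff R ‖y‖ • (M x - M y) := by
      rw [sub_smul, smul_sub]; abel
    have h1 : ‖(cutoff R ‖x‖ - cutoff R ‖y‖) • M x‖ ≤ 4 * K * R * ‖x - y‖ := by
      rw [norm_smul, Real.norm_eq_abs]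
      have a1 := abs_cutoff_sub_le hR ‖x‖ ‖y‖
      have a2 : |‖x‖ - ‖y‖| / R ≤ ‖x - y‖ / R := by
        gcongr; exact abs_norm_sub_norm_le x y
      have a3 : ‖M x‖ ≤ K * (2 * R) * (2 * R) := (hMx x).trans (by gcongr)
      calc _ ≤ (‖x - y‖ / R) * (K * (2 * R) * (2 * R)) := by
            gcongr; exact a1.trans a2
        _ = _ := by field_simp; ring
    have h2 : ‖cutoff R ‖y‖ • (M x - M y)‖ ≤ 4 * K * R * ‖x - y‖ := by
      rw [norm_smul, Real.norm_eq_abs, abs_of_nonneg (cutoff_nonneg _ _)]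
      by_cases hy : ‖y‖ ≤ 2 * R
      · calc _ ≤ 1 * (K * (2 * R + 2 * R) * ‖x - y‖) := by
              gcongr
              · exact cutoff_le_one _ _
              · exact (hM x y).trans (by gcongr)
          _ = _ := by ring
      · rw [cutoff_eq_zero hR (not_le.1 hy).le, zero_mul]
        positivity
    rw [e]
    refine (norm_add_le _ _).trans ?_
    linarith
  by_cases hx : ‖x‖ ≤ 2 * R
  · exact key x y hx
  by_cases hy : ‖y‖ ≤ 2 * R
  · rw [norm_sub_rev, norm_sub_rev x y]; exact key y x hy
  · rw [cutoff_eq_zero hR (not_le.1 hx).le, cutoff_eq_zero hR (not_le.1 hy).le]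
    simp only [zero_smul, sub_self, norm_zero]
    positivity

/-- Before the right end point, the interval and the half-line have the same germ to the right of t.
The Grönwall lemmas require right derivatives. -/
lemma _root_.HasDerivWithinAt.Ici_of_Icc {f : ℝ → E} {f' : E} {a b t : ℝ}
    (h : HasDerivWithinAt f f' (Icc a b) t) (ht : t ∈ Ico a b) :
    HasDerivWithinAt f f' (Ici t) t :=
  h.mono_of_mem_nhdsWithin (Icc_mem_nhdsGE_of_mem ht)

namespace TameField

variable {M : ℝ → E → E} {A : E →L[ℝ] G} {K C : ℝ}

/-- The truncated field is globally bounded and Lipschitz, so Picard–Lindelöf covers all of [0, T]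
at once, without continuation. Conservation of ‖A a‖ makes the growth bound linear in ‖a‖, and
Grönwall then keeps the trajectory where the cut-off equals 1. -/
theorem exists_trajectory [CompleteSpace E] (h : TameField M A K C) (a₀ : E) {T : ℝ}
    (hT : 0 < T) :
    ∃ a : ℝ → E, a 0 = a₀ ∧ ∀ t ∈ Icc 0 T, HasDerivWithinAt a (M t (a t)) (Icc 0 T) t ∧
      ‖a t‖ ≤ ‖a₀‖ * Real.exp (C * ‖A a₀‖ * T) := by
  have hK := h.nonneg_lip
  have hC := h.nonneg_tame
  set B := ‖a₀‖ * Real.exp (C * ‖A a₀‖ * T) with hB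
  have hB0 : 0 ≤ B := by positivity
  -- B is the a priori bound; adding 1 keeps the radius positive when the datum is zero.
  set R := B + 1 with hRdef
  have hR : 0 < R := by positivity
  set f : ℝ → E → E := fun t x => cutoff R ‖x‖ • M t x with hf
  have hlip : ∀ t x y, ‖f t x - f t y‖ ≤ 8 * K * R * ‖x - y‖ := fun t x y =>
    norm_cutoff_smul_sub_le hK hR (h.map_zero t) (h.norm_sub_le t) x y
  have hMx : ∀ t x, ‖M t x‖ ≤ K * ‖x‖ * ‖x‖ := fun t x => by
    simpa [h.map_zero] using h.norm_sub_le t x 0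
  have hbd : ∀ t x, ‖f t x‖ ≤ 4 * K * R ^ 2 := by
    intro t x
    simp only [hf, norm_smul, Real.norm_eq_abs, abs_of_nonneg (cutoff_nonneg _ _)]
    by_cases hx : ‖x‖ ≤ 2 * R
    · calc _ ≤ 1 * (K * (2 * R) * (2 * R)) := by
            gcongr
            · exact cutoff_le_one _ _
            · exact (hMx t x).trans (by gcongr)
        _ = _ := by ring
    · rw [cutoff_eq_zero hR (not_le.1 hx).le, zero_mul]
      positivity
  have h0T : (0 : ℝ) ∈ Icc 0 T := ⟨le_rfl, hT.le⟩
  -- The ball has radius (bound on f) × T, so no solution can leave it before time T.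
  have hPL : IsPicardLindelof f (⟨0, h0T⟩ : Icc (0 : ℝ) T) a₀
      (⟨4 * K * R ^ 2 * T, by positivity⟩ : ℝ≥0) 0 (⟨4 * K * R ^ 2, by positivity⟩ : ℝ≥0)
      (⟨8 * K * R, by positivity⟩ : ℝ≥0) := by
    refine ⟨fun t _ => ?_, fun x _ => ?_, fun t _ x _ => hbd t x, ?_⟩
    · refine (LipschitzWith.of_dist_le_mul fun x y => ?_).lipschitzOnWith
      rw [dist_eq_norm, dist_eq_norm]
      exact hlip t x y
    · exact ((h.continuous_time x).const_smul _).continuousOn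
    · simp [hT.le]
      exact le_rfl
  obtain ⟨a, ha0, ha⟩ := hPL.exists_eq_forall_mem_Icc_hasDerivWithinAt₀
  have ha0 : a 0 = a₀ := ha0
  have hcont : ContinuousOn a (Icc 0 T) := fun t ht => (ha t ht).continuousWithinAt
  -- The cut-off is a scalar factor, so the truncated field conserves the same quadratic form. This
  -- is known before the cut-off is shown to be inactive.
  have hE : ∀ t ∈ Icc 0 T, ‖A (a t)‖ ^ 2 = ‖A (a 0)‖ ^ 2 := by
    have hd : ∀ t ∈ Icc 0 T, HasDerivWithinAt (fun t => ‖A (a t)‖ ^ 2) 0 (Icc 0 T) t := by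
      intro t ht
      have h1 : HasDerivWithinAt (fun t => A (a t)) (A (f t (a t))) (Icc 0 T) t :=
        A.hasFDerivAt.comp_hasDerivWithinAt t (ha t ht)
      have h2 := h1.norm_sq
      have h3 : inner ℝ (A (a t)) (A (f t (a t))) = 0 := by
        simp only [hf, map_smul, inner_smul_right, h.inner_eq_zero, mul_zero]
      rwa [h3, mul_zero] at h2
    exact constant_of_has_deriv_right_zero (fun t ht => (hd t ht).continuousWithinAt)
      fun t ht => (hd t (Ico_subset_Icc_self ht)).Ici_of_Icc ht
  have hE' : ∀ t ∈ Icc 0 T, ‖A (a t)‖ = ‖A a₀‖ := fun t ht => by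
    have := hE t ht
    rw [ha0] at this
    exact (sq_eq_sq₀ (norm_nonneg _) (norm_nonneg _)).1 this
  have hgr := norm_le_gronwallBound_of_norm_deriv_right_le (f := a) (δ := ‖a₀‖)
    (K := C * ‖A a₀‖) (ε := 0) hcont
    (fun t ht => (ha t (Ico_subset_Icc_self ht)).Ici_of_Icc ht) (by rw [ha0]) (by
      intro t ht
      simp only [hf, norm_smul, Real.norm_eq_abs, abs_of_nonneg (cutoff_nonneg _ _), add_zero]
      calc _ ≤ 1 * (C * ‖A (a t)‖ * ‖a t‖) := by
            gcongr
            · exact cutoff_le_one _ _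
            · exact h.norm_le t _
        _ = _ := by rw [hE' t (Ico_subset_Icc_self ht), one_mul])
  have hbound : ∀ t ∈ Icc 0 T, ‖a t‖ ≤ B := by
    intro t ht
    have := hgr t ht
    rw [gronwallBound_ε0, sub_zero] at this
    refine this.trans ?_
    rw [hB]
    gcongr
    exact ht.2
  refine ⟨a, ha0, fun t ht => ⟨?_, hbound t ht⟩⟩
  have := ha t ht
  simp only [hf] at this
  rwa [cutoff_eq_one hR ((hbound t ht).trans (by linarith)), one_smul] at this

/-- Grönwall for the difference: on the ball of radius R the field has Lipschitz constant K(R + R).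
-/
theorem norm_sub_le_of_trajectories (h : TameField M A K C) {a b : ℝ → E} {T R : ℝ}
    (ha : ∀ t ∈ Icc 0 T, HasDerivWithinAt a (M t (a t)) (Icc 0 T) t)
    (hb : ∀ t ∈ Icc 0 T, HasDerivWithinAt b (M t (b t)) (Icc 0 T) t)
    (haR : ∀ t ∈ Icc 0 T, ‖a t‖ ≤ R) (hbR : ∀ t ∈ Icc 0 T, ‖b t‖ ≤ R) :
    ∀ t ∈ Icc 0 T, ‖a t - b t‖ ≤ ‖a 0 - b 0‖ * Real.exp (2 * K * R * T) := by
  have hK := h.nonneg_lip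
  intro t ht
  have hR : 0 ≤ R := (norm_nonneg _).trans (haR t ht)
  have hgr := norm_le_gronwallBound_of_norm_deriv_right_le (f := fun t => a t - b t)
    (δ := ‖a 0 - b 0‖) (K := 2 * K * R) (ε := 0) (a := 0) (b := T)
    (fun t ht => ((ha t ht).sub (hb t ht)).continuousWithinAt)
    (fun t ht => ((ha t (Ico_subset_Icc_self ht)).sub
      (hb t (Ico_subset_Icc_self ht))).Ici_of_Icc ht) le_rfl (by
      intro t ht
      have h1 := haR t (Ico_subset_Icc_self ht)
      have h2 := hbR t (Ico_subset_Icc_self ht)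
      calc _ ≤ K * (‖a t‖ + ‖b t‖) * ‖a t - b t‖ := h.norm_sub_le t _ _
        _ ≤ K * (R + R) * ‖a t - b t‖ := by gcongr
        _ = _ := by ring) t ht
  rw [gronwallBound_ε0, sub_zero] at hgr
  refine hgr.trans ?_
  gcongr
  exact ht.2

end TameField

end AbstractODE

/-- Complex-valued `L²` functions on the line. -/
noncomputable abbrev L2C := Lp ℂ 2 (volume : Measure ℝ)

/-! ### Fourier multipliers on L² -/

section Multiplier

/-- Bounded measurable functions, acting on `L²` by multiplication. -/
structure IsMultiplier (φ : ℝ → ℂ) : Prop where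
  measurable : Measurable φ
  bounded : ∃ C, ∀ ξ, ‖φ ξ‖ ≤ C

lemma IsMultiplier.mul {φ ψ : ℝ → ℂ} (hφ : IsMultiplier φ) (hψ : IsMultiplier ψ) :
    IsMultiplier fun ξ => φ ξ * ψ ξ := by
  obtain ⟨C, hC⟩ := hφ.bounded
  obtain ⟨D, hD⟩ := hψ.bounded
  refine ⟨hφ.measurable.mul hψ.measurable, C * D, fun ξ => ?_⟩
  rw [norm_mul]
  exact mul_le_mul (hC ξ) (hD ξ) (norm_nonneg _) ((norm_nonneg _).trans (hC ξ))

lemma IsMultiplier.memLp_mul {φ f : ℝ → ℂ} (hφ : IsMultiplier φ) (hf : MemLp f 2 volume) :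
    MemLp (fun ξ => φ ξ * f ξ) 2 volume := by
  obtain ⟨C, hC⟩ := hφ.bounded
  refine hf.of_le_mul (c := C)
    (hφ.measurable.aestronglyMeasurable.mul hf.aestronglyMeasurable) (.of_forall fun ξ => ?_)
  rw [norm_mul]
  exact mul_le_mul_of_nonneg_right (hC ξ) (norm_nonneg _)

lemma norm_toLp_mul_le {φ : ℝ → ℂ} (hφ : IsMultiplier φ) {C : ℝ} (hC : ∀ ξ, ‖φ ξ‖ ≤ C) (f : L2C) :
    ‖(hφ.memLp_mul (Lp.memLp f)).toLp _‖ ≤ C * ‖f‖ := by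
  refine Lp.norm_le_mul_norm_of_ae_le_mul ?_
  filter_upwards [(hφ.memLp_mul (Lp.memLp f)).coeFn_toLp] with ξ h
  rw [h, norm_mul]
  exact mul_le_mul_of_nonneg_right (hC ξ) (norm_nonneg _)

open Classical in
/-- Multiplication by `φ` as an operator on `L²` (zero unless `φ` is bounded and measurable). -/
noncomputable def mulL (φ : ℝ → ℂ) : L2C →L[ℂ] L2C :=
  if h : IsMultiplier φ then
    LinearMap.mkContinuous
      { toFun := fun f => (h.memLp_mul (Lp.memLp f)).toLp _
        map_add' := fun f g => by
          ext1
          filter_upwards [(h.memLp_mul (Lp.memLp (f + g))).coeFn_toLp,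
            Lp.coeFn_add ((h.memLp_mul (Lp.memLp f)).toLp _) ((h.memLp_mul (Lp.memLp g)).toLp _),
            (h.memLp_mul (Lp.memLp f)).coeFn_toLp, (h.memLp_mul (Lp.memLp g)).coeFn_toLp,
            Lp.coeFn_add f g] with ξ h1 h2 h3 h4 h5
          rw [h1, h2, Pi.add_apply, h3, h4, h5, Pi.add_apply, mul_add]
        map_smul' := fun c f => by
          ext1
          filter_upwards [(h.memLp_mul (Lp.memLp (c • f))).coeFn_toLp,
            Lp.coeFn_smul c ((h.memLp_mul (Lp.memLp f)).toLp _),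
            (h.memLp_mul (Lp.memLp f)).coeFn_toLp,
            Lp.coeFn_smul c f] with ξ h1 h2 h3 h4
          rw [RingHom.id_apply, h1, h2, Pi.smul_apply, h3, h4, Pi.smul_apply, smul_eq_mul,
            smul_eq_mul]
          ring }
      h.bounded.choose fun f => norm_toLp_mul_le h h.bounded.choose_spec f
  else 0

variable {φ ψ : ℝ → ℂ}

lemma mulL_coe (h : IsMultiplier φ) (f : L2C) : mulL φ f =ᵐ[volume] fun ξ => φ ξ * f ξ := by
  rw [mulL, dif_pos h]
  exact (h.memLp_mul (Lp.memLp f)).coeFn_toLp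

lemma norm_mulL_le (h : IsMultiplier φ) {C : ℝ} (hC : ∀ ξ, ‖φ ξ‖ ≤ C) (f : L2C) :
    ‖mulL φ f‖ ≤ C * ‖f‖ := by
  rw [mulL, dif_pos h]
  exact norm_toLp_mul_le h hC f

lemma mulL_mulL (hφ : IsMultiplier φ) (hψ : IsMultiplier ψ) (f : L2C) :
    mulL φ (mulL ψ f) = mulL (fun ξ => φ ξ * ψ ξ) f := by
  ext1
  filter_upwards [mulL_coe hφ (mulL ψ f), mulL_coe hψ f, mulL_coe (hφ.mul hψ) f] with ξ h1 h2 h3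
  rw [h1, h2, h3, mul_assoc]

lemma mulL_comm (hφ : IsMultiplier φ) (hψ : IsMultiplier ψ) (f : L2C) :
    mulL φ (mulL ψ f) = mulL ψ (mulL φ f) := by
  rw [mulL_mulL hφ hψ, mulL_mulL hψ hφ]
  simp_rw [mul_comm]

lemma norm_mulL_eq (h : IsMultiplier φ) (h1 : ∀ ξ, ‖φ ξ‖ = 1) (f : L2C) : ‖mulL φ f‖ = ‖f‖ := by
  rw [Lp.norm_def, Lp.norm_def]
  congr 1
  refine eLpNorm_congr_norm_ae ?_
  filter_upwards [mulL_coe h f] with ξ hξ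
  rw [hξ, norm_mul, h1, one_mul]

lemma inner_mulL_left (h : IsMultiplier φ) (h' : IsMultiplier fun ξ => star (φ ξ)) (f g : L2C) :
    inner ℂ (mulL φ f) g = inner ℂ f (mulL (fun ξ => star (φ ξ)) g) := by
  rw [L2.inner_def, L2.inner_def]
  refine integral_congr_ae ?_
  filter_upwards [mulL_coe h f, mulL_coe h' g] with ξ h1 h2
  rw [h1, h2]
  simp only [RCLike.inner_apply, map_mul, RCLike.star_def]
  ring

/-- Energy conservation is stated with the real inner product, while adjoints of multipliers are
taken in the complex one. -/
lemma real_inner_eq_re_inner (f g : L2C) : inner ℝ f g = (inner ℂ f g).re := by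
  rw [L2.inner_def, L2.inner_def, ← RCLike.re_eq_complex_re, ← integral_re (L2.integrable_inner f g)]
  rfl

end Multiplier

/-! ### Convolution and Young's inequality -/

section Convolution

/-- Convolution of nonnegative extended real functions on the line. -/
noncomputable def lconv (p q : ℝ → ℝ≥0∞) (ξ : ℝ) : ℝ≥0∞ := ∫⁻ η, p η * q (ξ - η)

lemma measurable_lconv {p q : ℝ → ℝ≥0∞} (hp : Measurable p) (hq : Measurable q) :
    Measurable (lconv p q) := by
  unfold lconv
  refine Measurable.lintegral_prod_right' (f := fun z : ℝ × ℝ => p z.2 * q (z.1 - z.2)) ?_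
  fun_prop

lemma lconv_comm (p q : ℝ → ℝ≥0∞) : lconv p q = lconv q p := by
  ext ξ
  rw [lconv, ← lintegral_sub_left_eq_self _ ξ]
  simp only [lconv, sub_sub_cancel, mul_comm]

/-- Young's inequality for the convolution of an `L¹` function with an `L²` function. -/
lemma eLpNorm_lconv_le {p q : ℝ → ℝ≥0∞} (hp : Measurable p) (hq : Measurable q) :
    eLpNorm (lconv p q) 2 volume ≤ eLpNorm p 1 volume * eLpNorm q 2 volume := by
  have e2 : ∀ f : ℝ → ℝ≥0∞, eLpNorm f 2 volume = (∫⁻ ξ, f ξ ^ (2 : ℝ)) ^ (1 / 2 : ℝ) := fun f => by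
    rw [eLpNorm_eq_lintegral_rpow_enorm_toReal (by norm_num) (by norm_num)]
    simp
  -- Cauchy–Schwarz after splitting p = p^{1/2} · p^{1/2}; Tonelli then integrates in ξ.
  have key : ∀ ξ, lconv p q ξ ^ (2 : ℝ) ≤ (∫⁻ η, p η) * ∫⁻ η, p η * q (ξ - η) ^ (2 : ℝ) := by
    intro ξ
    have h := ENNReal.lintegral_mul_le_Lp_mul_Lq (volume : Measure ℝ) Real.HolderConjugate.two_two
      (f := fun η => p η ^ (1 / 2 : ℝ)) (g := fun η => p η ^ (1 / 2 : ℝ) * q (ξ - η))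
      (by fun_prop) (by fun_prop)
    have a1 : ∀ η, ((fun η => p η ^ (1 / 2 : ℝ)) * (fun η => p η ^ (1 / 2 : ℝ) * q (ξ - η))) η
        = p η * q (ξ - η) := fun η => by
      rw [Pi.mul_apply, ← mul_assoc, ← ENNReal.rpow_add_of_nonneg _ _ (by norm_num) (by norm_num)]
      norm_num
    have a2 : ∀ η, (p η ^ (1 / 2 : ℝ)) ^ (2 : ℝ) = p η := fun η => by
      rw [← ENNReal.rpow_mul]; norm_num
    simp only [a1, ENNReal.mul_rpow_of_nonneg _ _ (zero_le_two : (0 : ℝ) ≤ 2), a2] at h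
    have h2 := ENNReal.rpow_le_rpow h (zero_le_two : (0 : ℝ) ≤ 2)
    rw [ENNReal.mul_rpow_of_nonneg _ _ (zero_le_two : (0 : ℝ) ≤ 2), ← ENNReal.rpow_mul,
      ← ENNReal.rpow_mul] at h2
    norm_num at h2
    simpa [lconv] using h2
  have h3 : ∫⁻ ξ, lconv p q ξ ^ (2 : ℝ) ≤ (∫⁻ η, p η) * ((∫⁻ η, p η) * ∫⁻ η, q η ^ (2 : ℝ)) := by
    calc ∫⁻ ξ, lconv p q ξ ^ (2 : ℝ)
        ≤ ∫⁻ ξ, (∫⁻ η, p η) * ∫⁻ η, p η * q (ξ - η) ^ (2 : ℝ) := lintegral_mono key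
      _ = (∫⁻ η, p η) * ∫⁻ ξ, ∫⁻ η, p η * q (ξ - η) ^ (2 : ℝ) := by
          rw [lintegral_const_mul]
          refine Measurable.lintegral_prod_right'
            (f := fun z : ℝ × ℝ => p z.2 * q (z.1 - z.2) ^ (2 : ℝ)) ?_
          fun_prop
      _ = (∫⁻ η, p η) * ∫⁻ η, ∫⁻ ξ, p η * q (ξ - η) ^ (2 : ℝ) := by
          rw [lintegral_lintegral_swap]
          exact Measurable.aemeasurable (by unfold Function.uncurry; fun_prop)
      _ = _ := by
          congr 1
          rw [← lintegral_mul_const _ hp]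
          refine lintegral_congr fun η => ?_
          rw [lintegral_const_mul _ (by fun_prop),
            lintegral_sub_right_eq_self (fun ξ => q ξ ^ (2 : ℝ)) η]
  rw [e2, e2, eLpNorm_one_eq_lintegral_enorm]
  calc _ ≤ ((∫⁻ η, p η) * ((∫⁻ η, p η) * ∫⁻ η, q η ^ (2 : ℝ))) ^ (1 / 2 : ℝ) :=
        ENNReal.rpow_le_rpow h3 (by norm_num)
    _ = ((∫⁻ η, p η) ^ (2 : ℝ)) ^ (1 / 2 : ℝ) * (∫⁻ η, q η ^ (2 : ℝ)) ^ (1 / 2 : ℝ) := by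
        rw [← mul_assoc, ENNReal.mul_rpow_of_nonneg _ _ (by norm_num), ENNReal.rpow_two, sq]
    _ = _ := by
        rw [← ENNReal.rpow_mul]; norm_num

/-- Convolution of complex-valued functions on the line. -/
noncomputable def conv (f g : ℝ → ℂ) (ξ : ℝ) : ℂ := ∫ η, f η * g (ξ - η)

lemma measurable_conv {f g : ℝ → ℂ} (hf : Measurable f) (hg : Measurable g) :
    Measurable (conv f g) := by
  refine StronglyMeasurable.measurable ?_
  refine StronglyMeasurable.integral_prod_right (f := fun ξ η => f η * g (ξ - η)) ?_
  exact Measurable.stronglyMeasurable (by unfold Function.uncurry; fun_prop)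

lemma conv_comm (f g : ℝ → ℂ) : conv f g = conv g f := by
  ext ξ
  rw [conv, ← integral_sub_left_eq_self _ _ ξ]
  simp only [conv, sub_sub_cancel, mul_comm]

lemma enorm_conv_le (f g : ℝ → ℂ) (ξ : ℝ) :
    ‖conv f g ξ‖ₑ ≤ lconv (fun η => ‖f η‖ₑ) (fun η => ‖g η‖ₑ) ξ := by
  refine (enorm_integral_le_lintegral_enorm _).trans_eq ?_
  simp only [lconv, enorm_mul]

lemma eLpNorm_conv_le {f g : ℝ → ℂ} (hf : Measurable f) (hg : Measurable g) :
    eLpNorm (conv f g) 2 volume ≤ eLpNorm f 1 volume * eLpNorm g 2 volume := by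
  refine (eLpNorm_mono_enorm (g := lconv (fun η => ‖f η‖ₑ) (fun η => ‖g η‖ₑ)) fun ξ => ?_).trans
    ((eLpNorm_lconv_le hf.enorm hg.enorm).trans_eq ?_)
  · exact enorm_conv_le f g ξ
  · simp only [eLpNorm_enorm]

/-- With both factors in L², the integrand is integrable for every ξ rather than almost every ξ, so
convolution is bilinear pointwise. -/
lemma integrable_conv_integrand {f g : ℝ → ℂ} (hf : MemLp f 2 volume) (hg : MemLp g 2 volume)
    (ξ : ℝ) : Integrable fun η => f η * g (ξ - η) :=
  hf.integrable_mul (hg.comp_measurePreserving (Measure.measurePreserving_sub_left volume ξ))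

lemma conv_congr_left {f f' g : ℝ → ℂ} (h : f =ᵐ[volume] f') : conv f g = conv f' g := by
  ext ξ
  refine integral_congr_ae ?_
  filter_upwards [h] with η hη
  rw [hη]

lemma conv_sub_left {f f' g : ℝ → ℂ} (hf : MemLp f 2 volume) (hf' : MemLp f' 2 volume)
    (hg : MemLp g 2 volume) : conv (f - f') g = conv f g - conv f' g := by
  ext ξ
  simp only [conv, Pi.sub_apply, sub_mul]
  exact integral_sub (integrable_conv_integrand hf hg ξ) (integrable_conv_integrand hf' hg ξ)

lemma conv_neg_eq_star {f g : ℝ → ℂ} (hf : (fun ξ => f (-ξ)) =ᵐ[volume] fun ξ => star (f ξ))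
    (hg : (fun ξ => g (-ξ)) =ᵐ[volume] fun ξ => star (g ξ)) (ξ : ℝ) :
    conv f g (-ξ) = star (conv f g ξ) := by
  have h1 : conv f g (-ξ) = ∫ η, f (-η) * g (-(ξ - η)) := by
    rw [conv, ← integral_neg_eq_self]
    simp only [neg_sub, sub_neg_eq_add, neg_add_eq_sub]
  rw [h1, conv, RCLike.star_def, ← integral_conj]
  refine integral_congr_ae ?_
  filter_upwards [hf, (Measure.measurePreserving_sub_left volume ξ).quasiMeasurePreserving.ae hg]
    with η h2 h3
  rw [h2, h3, map_mul]
  rfl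

end Convolution

/-! ### Weights and symbols of the equation -/

section Symbols

/-- The weight of the conserved energy `∫ u² + γ u_x²` on the Fourier side (before squaring). -/
noncomputable def energyWeight (γ ξ : ℝ) : ℝ := √(1 + γ * (2 * Real.pi * ξ) ^ 2)

/-- The symbol of `-(3/4) ∂ₓ (1 - γ ∂ₓ²)⁻¹`. -/
noncomputable def nonlinSymbol (γ ξ : ℝ) : ℂ :=
  -(3 / 4) * (Complex.I * (2 * Real.pi * ξ)) / (1 + γ * (2 * Real.pi * ξ) ^ 2)

/-- The symbol of `-(∂ₓ + ν ∂ₓ³) (1 - γ ∂ₓ²)⁻¹`, divided by `i`. -/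
noncomputable def phase (γ ν ξ : ℝ) : ℝ :=
  (-(2 * Real.pi * ξ) + ν * (2 * Real.pi * ξ) ^ 3) / (1 + γ * (2 * Real.pi * ξ) ^ 2)

variable {γ ν s : ℝ}

lemma continuous_sobolevWeight (s : ℝ) : Continuous (sobolevWeight s) :=
  Continuous.rpow_const (by fun_prop) fun ξ => Or.inl (by positivity)

lemma continuous_energyWeight (γ : ℝ) : Continuous (energyWeight γ) := by
  unfold energyWeight; fun_prop

lemma continuous_nonlinSymbol (hγ : 0 < γ) : Continuous (nonlinSymbol γ) := by
  unfold nonlinSymbol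
  refine Continuous.div (by fun_prop) (by fun_prop) fun ξ => ?_
  have : (0 : ℝ) < 1 + γ * (2 * Real.pi * ξ) ^ 2 := by positivity
  exact_mod_cast this.ne'

lemma continuous_phase (hγ : 0 < γ) (ν : ℝ) : Continuous (phase γ ν) := by
  unfold phase
  refine Continuous.div (by fun_prop) (by fun_prop) fun ξ => ?_
  positivity

lemma sobolevWeight_neg (s ξ : ℝ) : sobolevWeight s (-ξ) = sobolevWeight s ξ := by
  simp [sobolevWeight]

lemma phase_neg (γ ν ξ : ℝ) : phase γ ν (-ξ) = -phase γ ν ξ := by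
  simp only [phase, mul_neg, neg_sq]
  rw [← neg_div]
  congr 1
  ring

lemma nonlinSymbol_neg (γ ξ : ℝ) : nonlinSymbol γ (-ξ) = star (nonlinSymbol γ ξ) := by
  simp [nonlinSymbol, Complex.conj_ofReal]

lemma one_le_sobolevWeight (hs : 0 ≤ s) (ξ : ℝ) : 1 ≤ sobolevWeight s ξ :=
  Real.one_le_rpow (by nlinarith [sq_nonneg (2 * Real.pi * ξ)]) (by linarith)

lemma one_le_energyWeight (hγ : 0 < γ) (ξ : ℝ) : 1 ≤ energyWeight γ ξ := by
  rw [energyWeight, Real.one_le_sqrt]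
  have : 0 ≤ γ * (2 * Real.pi * ξ) ^ 2 := by positivity
  linarith

lemma energyWeight_pos (hγ : 0 < γ) (ξ : ℝ) : 0 < energyWeight γ ξ :=
  zero_lt_one.trans_le (one_le_energyWeight hγ ξ)

lemma sq_energyWeight (hγ : 0 < γ) (ξ : ℝ) :
    energyWeight γ ξ ^ 2 = 1 + γ * (2 * Real.pi * ξ) ^ 2 :=
  Real.sq_sqrt (by positivity)

/-- Splits off the one derivative that the energy controls. The remaining exponent (s - 1)/2 is
nonnegative when s ≥ 1. -/
lemma sobolevWeight_eq (s ξ : ℝ) : sobolevWeight s ξ =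
    (1 + (2 * Real.pi * ξ) ^ 2) ^ ((s - 1) / 2) * √(1 + (2 * Real.pi * ξ) ^ 2) := by
  rw [sobolevWeight, Real.sqrt_eq_rpow, ← Real.rpow_add (by positivity)]
  congr 1
  ring

lemma energyWeight_le (hγ : 0 < γ) (ξ : ℝ) :
    energyWeight γ ξ ≤ √(1 + γ) * √(1 + (2 * Real.pi * ξ) ^ 2) := by
  rw [energyWeight, ← Real.sqrt_mul (by positivity)]
  apply Real.sqrt_le_sqrt
  nlinarith [sq_nonneg (2 * Real.pi * ξ)]

lemma le_energyWeight (hγ : 0 < γ) (ξ : ℝ) :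
    √(min 1 γ) * √(1 + (2 * Real.pi * ξ) ^ 2) ≤ energyWeight γ ξ := by
  rw [energyWeight, ← Real.sqrt_mul (by positivity)]
  apply Real.sqrt_le_sqrt
  have h1 : min 1 γ ≤ 1 := min_le_left _ _
  have h2 : min 1 γ * (2 * Real.pi * ξ) ^ 2 ≤ γ * (2 * Real.pi * ξ) ^ 2 := by
    gcongr; exact min_le_right _ _
  linarith

lemma abs_freq_le (hγ : 0 < γ) (ξ : ℝ) : |2 * Real.pi * ξ| ≤ energyWeight γ ξ / √γ := by
  rw [le_div_iff₀ (by positivity), energyWeight, ← Real.sqrt_sq_eq_abs,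
    ← Real.sqrt_mul (by positivity)]
  apply Real.sqrt_le_sqrt
  linarith

lemma energyWeight_le_sobolevWeight (hγ : 0 < γ) (hs : 1 ≤ s) (ξ : ℝ) :
    energyWeight γ ξ ≤ √(1 + γ) * sobolevWeight s ξ := by
  refine (energyWeight_le hγ ξ).trans ?_
  rw [sobolevWeight_eq]
  gcongr
  refine le_mul_of_one_le_left (by positivity) (Real.one_le_rpow ?_ (by linarith))
  nlinarith [sq_nonneg (2 * Real.pi * ξ)]

/-- The symbol is of order -1: |κ| ≤ e/√γ over the denominator e². -/
lemma norm_nonlinSymbol_le (hγ : 0 < γ) (ξ : ℝ) :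
    ‖nonlinSymbol γ ξ‖ ≤ 3 / 4 / √γ / energyWeight γ ξ := by
  have he := energyWeight_pos hγ ξ
  have h1 : ‖nonlinSymbol γ ξ‖ = 3 / 4 * |2 * Real.pi * ξ| / energyWeight γ ξ ^ 2 := by
    rw [sq_energyWeight hγ, nonlinSymbol, norm_div, norm_mul, norm_mul]
    have h2 : ‖(1 + γ * (2 * Real.pi * ξ) ^ 2 : ℂ)‖ = 1 + γ * (2 * Real.pi * ξ) ^ 2 := by
      have h3 : (1 + γ * (2 * Real.pi * ξ) ^ 2 : ℂ) = ((1 + γ * (2 * Real.pi * ξ) ^ 2 : ℝ) : ℂ) := by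
        push_cast; rfl
      rw [h3, Complex.norm_real, Real.norm_eq_abs, abs_of_pos (by positivity)]
    have h4 : ‖(2 * Real.pi * ξ : ℂ)‖ = |2 * Real.pi * ξ| := by
      rw [← Real.norm_eq_abs, ← Complex.norm_real]; push_cast; rfl
    rw [h2, h4]
    norm_num
  rw [h1]
  calc _ ≤ 3 / 4 * (energyWeight γ ξ / √γ) / energyWeight γ ξ ^ 2 := by
        gcongr; exact abs_freq_le hγ ξ
    _ = _ := by field_simp

lemma norm_nonlinSymbol_le' (hγ : 0 < γ) (ξ : ℝ) : ‖nonlinSymbol γ ξ‖ ≤ 3 / 4 / √γ :=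
  (norm_nonlinSymbol_le hγ ξ).trans (div_le_self (by positivity) (one_le_energyWeight hγ ξ))

/-- A cubic over a quadratic: the linear part loses at most one derivative, which s ≥ 1 can absorb.
-/
lemma abs_phase_le (hγ : 0 < γ) (ν ξ : ℝ) :
    |phase γ ν ξ| ≤ (1 + |ν| / γ) / √γ * energyWeight γ ξ := by
  have he := energyWeight_pos hγ ξ
  have hq : (0 : ℝ) < 1 + γ * (2 * Real.pi * ξ) ^ 2 := by positivity
  have h1 : |-1 + ν * (2 * Real.pi * ξ) ^ 2| ≤ (1 + |ν| / γ) * (1 + γ * (2 * Real.pi * ξ) ^ 2) := by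
    refine (abs_add_le _ _).trans ?_
    rw [abs_mul, abs_of_nonneg (sq_nonneg (2 * Real.pi * ξ)), abs_neg, abs_one]
    have : (1 + |ν| / γ) * (1 + γ * (2 * Real.pi * ξ) ^ 2) = 1 + |ν| * (2 * Real.pi * ξ) ^ 2
        + (γ * (2 * Real.pi * ξ) ^ 2 + |ν| / γ) := by field_simp; ring
    rw [this]
    have : 0 ≤ γ * (2 * Real.pi * ξ) ^ 2 + |ν| / γ := by positivity
    linarith
  have h2 : phase γ ν ξ = (2 * Real.pi * ξ) * (-1 + ν * (2 * Real.pi * ξ) ^ 2)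
      / (1 + γ * (2 * Real.pi * ξ) ^ 2) := by
    rw [phase]; congr 1; ring
  rw [h2, abs_div, abs_mul, abs_of_pos hq, div_le_iff₀ hq]
  calc _ ≤ (energyWeight γ ξ / √γ) * ((1 + |ν| / γ) * (1 + γ * (2 * Real.pi * ξ) ^ 2)) := by
        gcongr; exact abs_freq_le hγ ξ
    _ = _ := by ring

/-- The weight `w_s / e` is comparable to a power of `1 + κ²`, hence subadditive up to a constant;
this is the inequality behind the tame product estimate. -/
lemma exists_norm_weight_mul_nonlinSymbol_le (hγ : 0 < γ) (hs : 1 ≤ s) :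
    ∃ C, 0 ≤ C ∧ ∀ a b, ‖(sobolevWeight s (a + b) : ℂ) * nonlinSymbol γ (a + b)‖ ≤
      C * (sobolevWeight s a / energyWeight γ a + sobolevWeight s b / energyWeight γ b) := by
  set r := (s - 1) / 2 with hr
  have hr0 : 0 ≤ r := by rw [hr]; linarith
  set c := √(min 1 γ) with hc
  have hc0 : 0 < c := Real.sqrt_pos.2 (lt_min one_pos hγ)
  set d := √(1 + γ) with hd
  set p : ℝ → ℝ := fun ξ => 1 + (2 * Real.pi * ξ) ^ 2 with hp
  have hp0 : ∀ ξ, 0 < p ξ := fun ξ => by simp only [hp]; positivity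
  -- Up to constants w_s/e is p^r, because e is comparable to p^{1/2}; subadditivity is checked on
  -- p^r.
  have hlow : ∀ ξ, p ξ ^ r ≤ d * (sobolevWeight s ξ / energyWeight γ ξ) := by
    intro ξ
    rw [← mul_div_assoc, le_div_iff₀ (energyWeight_pos hγ ξ), sobolevWeight_eq]
    calc p ξ ^ r * energyWeight γ ξ ≤ p ξ ^ r * (d * √(p ξ)) := by
          have := (hp0 ξ).le
          gcongr; exact energyWeight_le hγ ξ
      _ = _ := by ring
  have hup : ∀ ξ, sobolevWeight s ξ / energyWeight γ ξ ≤ p ξ ^ r / c := by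
    intro ξ
    rw [div_le_div_iff₀ (energyWeight_pos hγ ξ) hc0, sobolevWeight_eq, mul_assoc, mul_comm (√_) c]
    have := (hp0 ξ).le
    gcongr
    exact le_energyWeight hγ ξ
  have hsub : ∀ a b, p (a + b) ^ r ≤ 4 ^ r * (p a ^ r + p b ^ r) := by
    intro a b
    -- One factor 2 comes from (a + b)² ≤ 2(a² + b²), the other from replacing a sum by twice the
    -- maximum.
    have h1 : p (a + b) ≤ 4 * max (p a) (p b) := by
      have e1 := le_max_left (p a) (p b)
      have e2 := le_max_right (p a) (p b)
      have : p (a + b) ≤ 2 * (p a + p b) := by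
        simp only [hp]
        nlinarith [sq_nonneg (2 * Real.pi * a - 2 * Real.pi * b)]
      linarith
    have ha := (hp0 a).le
    have hb := (hp0 b).le
    calc p (a + b) ^ r ≤ (4 * max (p a) (p b)) ^ r := Real.rpow_le_rpow (hp0 _).le h1 hr0
      _ = 4 ^ r * (max (p a) (p b)) ^ r := Real.mul_rpow (by norm_num) (le_max_of_le_left ha)
      _ ≤ _ := by
        gcongr
        have ha' : 0 ≤ p a ^ r := by positivity
        have hb' : 0 ≤ p b ^ r := by positivity
        rcases max_cases (p a) (p b) with h | h <;> rw [h.1] <;> linarith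
  refine ⟨3 / 4 / √γ * (4 ^ r * d / c), by positivity, fun a b => ?_⟩
  rw [norm_mul, Complex.norm_real, Real.norm_eq_abs, abs_of_pos (sobolevWeight_pos _ _)]
  have hw := sobolevWeight_pos s (a + b)
  calc sobolevWeight s (a + b) * ‖nonlinSymbol γ (a + b)‖
      ≤ sobolevWeight s (a + b) * (3 / 4 / √γ / energyWeight γ (a + b)) := by
        gcongr; exact norm_nonlinSymbol_le hγ _
    _ = 3 / 4 / √γ * (sobolevWeight s (a + b) / energyWeight γ (a + b)) := by ring
    _ ≤ 3 / 4 / √γ * (p (a + b) ^ r / c) :=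
        mul_le_mul_of_nonneg_left (hup _) (by positivity)
    _ ≤ 3 / 4 / √γ * ((4 ^ r * (p a ^ r + p b ^ r)) / c) := by gcongr; exact hsub a b
    _ ≤ 3 / 4 / √γ * ((4 ^ r * (d * (sobolevWeight s a / energyWeight γ a)
          + d * (sobolevWeight s b / energyWeight γ b))) / c) := by
        gcongr
        · exact hlow a
        · exact hlow b
    _ = _ := by ring

/-- The square 1/(1 + γκ²) is a rescaled 1/(1 + x²). This is where one derivative in one dimension
suffices to put û in L¹. -/
lemma memLp_inv_energyWeight (hγ : 0 < γ) :
    MemLp (fun ξ => ((energyWeight γ ξ)⁻¹ : ℂ)) 2 volume := by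
  have hm : AEStronglyMeasurable (fun ξ => ((energyWeight γ ξ)⁻¹ : ℂ)) volume := by
    have := (continuous_energyWeight γ).measurable
    exact Measurable.aestronglyMeasurable (by fun_prop)
  rw [memLp_two_iff_integrable_sq_norm hm]
  have hne : √γ * (2 * Real.pi) ≠ 0 := by positivity
  refine (integrable_inv_one_add_sq.comp_mul_left' hne).congr (.of_forall fun ξ => ?_)
  simp only [norm_inv, Complex.norm_real, Real.norm_eq_abs, inv_pow, sq_abs, sq_energyWeight hγ]
  congr 2
  rw [mul_assoc, mul_pow (√γ), Real.sq_sqrt hγ.le]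

end Symbols

/-! ### The nonlinearity and its tame estimates -/

section Bilinear

variable {γ ν s : ℝ}

/-- The multiplier `1 / w_s`. -/
noncomputable def invWeight (s ξ : ℝ) : ℂ := ((sobolevWeight s ξ)⁻¹ : ℝ)

/-- The multiplier `e / w_s`. -/
noncomputable def energyRatio (γ s ξ : ℝ) : ℂ := (energyWeight γ ξ * (sobolevWeight s ξ)⁻¹ : ℝ)

lemma isMultiplier_invWeight (hs : 0 ≤ s) : IsMultiplier (invWeight s) := by
  refine ⟨?_, 1, fun ξ => ?_⟩
  · have := (continuous_sobolevWeight s).measurable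
    unfold invWeight
    fun_prop
  · rw [invWeight, Complex.norm_real, Real.norm_eq_abs, abs_of_pos (inv_pos.2 (sobolevWeight_pos s ξ))]
    exact inv_le_one_of_one_le₀ (one_le_sobolevWeight hs ξ)

lemma norm_energyRatio_le (hγ : 0 < γ) (hs : 1 ≤ s) (ξ : ℝ) : ‖energyRatio γ s ξ‖ ≤ √(1 + γ) := by
  have hw := sobolevWeight_pos s ξ
  have he := energyWeight_pos hγ ξ
  rw [energyRatio, Complex.norm_real, Real.norm_eq_abs, abs_of_pos (by positivity),
    ← div_eq_mul_inv, div_le_iff₀ hw]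
  exact energyWeight_le_sobolevWeight hγ hs ξ

lemma isMultiplier_energyRatio (hγ : 0 < γ) (hs : 1 ≤ s) : IsMultiplier (energyRatio γ s) := by
  refine ⟨?_, _, norm_energyRatio_le hγ hs⟩
  have := (continuous_sobolevWeight s).measurable
  have := (continuous_energyWeight γ).measurable
  unfold energyRatio
  fun_prop

/-- Cauchy–Schwarz for û = e⁻¹ · (e û): the energy norm alone controls û in L¹. -/
lemma eLpNorm_invWeight_one_le (hγ : 0 < γ) (hs : 1 ≤ s) (g : L2C) :
    eLpNorm (mulL (invWeight s) g) 1 volume ≤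
      eLpNorm (fun ξ => ((energyWeight γ ξ)⁻¹ : ℂ)) 2 volume *
        eLpNorm (mulL (energyRatio γ s) g) 2 volume := by
  have h : (mulL (invWeight s) g : ℝ → ℂ) =ᵐ[volume]
      (fun ξ => ((energyWeight γ ξ)⁻¹ : ℂ)) • (mulL (energyRatio γ s) g : ℝ → ℂ) := by
    filter_upwards [mulL_coe (isMultiplier_invWeight (s := s) (by linarith)) g,
      mulL_coe (isMultiplier_energyRatio hγ hs) g] with ξ h1 h2
    have he : (energyWeight γ ξ : ℂ) ≠ 0 := by exact_mod_cast (energyWeight_pos hγ ξ).ne'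
    rw [Pi.smul_apply', h1, h2, smul_eq_mul, invWeight, energyRatio]
    push_cast
    field_simp
  rw [eLpNorm_congr_ae h]
  exact eLpNorm_smul_le_mul_eLpNorm (Lp.aestronglyMeasurable _)
    (memLp_inv_energyWeight hγ).aestronglyMeasurable

/-- The tame estimate for `w_s m (f * g)`. -/
lemma exists_eLpNorm_weight_conv_le (hγ : 0 < γ) (hs : 1 ≤ s) : ∃ C : ℝ, 0 ≤ C ∧
    ∀ f g : ℝ → ℂ, Measurable f → Measurable g →
    eLpNorm (fun ξ => sobolevWeight s ξ * nonlinSymbol γ ξ * conv f g ξ) 2 volume ≤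
      ENNReal.ofReal C *
        (eLpNorm (fun ξ => (sobolevWeight s ξ / energyWeight γ ξ : ℝ) * f ξ) 2 volume *
          eLpNorm g 1 volume +
        eLpNorm f 1 volume *
          eLpNorm (fun ξ => (sobolevWeight s ξ / energyWeight γ ξ : ℝ) * g ξ) 2 volume) := by
  obtain ⟨C, hC0, hC⟩ := exists_norm_weight_mul_nonlinSymbol_le hγ hs
  refine ⟨C, hC0, fun f g hf hg => ?_⟩
  set θ : ℝ → ℝ := fun ξ => sobolevWeight s ξ / energyWeight γ ξ with hθ
  have hθ0 : ∀ ξ, 0 ≤ θ ξ := fun ξ =>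
    div_nonneg (sobolevWeight_pos s ξ).le (energyWeight_pos hγ ξ).le
  have hθm : Measurable θ :=
    (continuous_sobolevWeight s).measurable.div (continuous_energyWeight γ).measurable
  have hCb : ∀ a b, ‖(sobolevWeight s (a + b) : ℂ) * nonlinSymbol γ (a + b)‖ₑ ≤
      ENNReal.ofReal C * (‖θ a‖ₑ + ‖θ b‖ₑ) := by
    intro a b
    rw [← ofReal_norm, Real.enorm_of_nonneg (hθ0 a), Real.enorm_of_nonneg (hθ0 b),
      ← ENNReal.ofReal_add (hθ0 a) (hθ0 b), ← ENNReal.ofReal_mul hC0]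
    exact ENNReal.ofReal_le_ofReal (hC a b)
  set P₁ := lconv (fun η => ‖(θ η : ℂ) * f η‖ₑ) (fun η => ‖g η‖ₑ) with hP₁
  set P₂ := lconv (fun η => ‖f η‖ₑ) (fun η => ‖(θ η : ℂ) * g η‖ₑ) with hP₂
  have hm₁ : Measurable P₁ := measurable_lconv (by fun_prop) (by fun_prop)
  have hm₂ : Measurable P₂ := measurable_lconv (by fun_prop) (by fun_prop)
  -- Under the convolution integral ξ = η + (ξ - η), so the weight at ξ passes to either of the two
  -- factors.
  have hpt : ∀ ξ, ‖sobolevWeight s ξ * nonlinSymbol γ ξ * conv f g ξ‖ₑ ≤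
      (C.toNNReal : ℝ≥0∞) * ‖(P₁ + P₂) ξ‖ₑ := by
    intro ξ
    rw [enorm_mul, enorm_eq_self]
    refine (mul_le_mul_right (enorm_conv_le f g ξ) _).trans ?_
    rw [lconv, ← lintegral_const_mul _ (by fun_prop), Pi.add_apply, hP₁, hP₂, lconv, lconv,
      ← lintegral_add_left (by fun_prop), ← lintegral_const_mul _ (by fun_prop)]
    refine lintegral_mono fun η => ?_
    have h := hCb η (ξ - η)
    rw [add_sub_cancel] at h
    have e : ∀ x : ℝ, ‖(x : ℂ)‖ₑ = ‖x‖ₑ := fun x => by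
      rw [← ofReal_norm, ← ofReal_norm, Complex.norm_real]
    calc _ ≤ ENNReal.ofReal C * (‖θ η‖ₑ + ‖θ (ξ - η)‖ₑ) * (‖f η‖ₑ * ‖g (ξ - η)‖ₑ) := by
          gcongr
      _ = _ := by
          rw [enorm_mul, enorm_mul, e, e, ENNReal.ofReal]
          ring
  refine (eLpNorm_le_mul_eLpNorm_of_ae_le_mul' (.of_forall hpt) 2).trans ?_
  rw [ENNReal.ofReal]
  gcongr
  -- Young's inequality in each term, with the unweighted factor in L¹ and the weighted one in L².
  refine (eLpNorm_add_le hm₁.aestronglyMeasurable hm₂.aestronglyMeasurable (by norm_num)).trans ?_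
  gcongr
  · rw [hP₁, lconv_comm, mul_comm]
    refine (eLpNorm_lconv_le hg.enorm (by fun_prop)).trans_eq ?_
    rw [eLpNorm_enorm, eLpNorm_enorm]
  · refine (eLpNorm_lconv_le hf.enorm (by fun_prop)).trans_eq ?_
    rw [eLpNorm_enorm, eLpNorm_enorm]

/-- The function `w_s m (g / w_s * h / w_s)`: the nonlinearity `-(3/4) ∂ₓ (1 - γ ∂ₓ²)⁻¹ (u v)` for
`w_s û = g` and `w_s v̂ = h`, on the Fourier side and multiplied by the weight `w_s`. -/
noncomputable def bilinFun (γ s : ℝ) (g h : L2C) (ξ : ℝ) : ℂ :=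
  sobolevWeight s ξ * nonlinSymbol γ ξ * conv (mulL (invWeight s) g) (mulL (invWeight s) h) ξ

lemma measurable_Lp (f : L2C) : Measurable f := (Lp.stronglyMeasurable f).measurable

lemma measurable_bilinFun (hγ : 0 < γ) (s : ℝ) (g h : L2C) : Measurable (bilinFun γ s g h) := by
  have h1 := (continuous_sobolevWeight s).measurable
  have h2 := (continuous_nonlinSymbol hγ).measurable
  have h3 := measurable_conv (measurable_Lp (mulL (invWeight s) g))
    (measurable_Lp (mulL (invWeight s) h))
  unfold bilinFun
  fun_prop

lemma eLpNorm_eq_ofReal (f : L2C) : eLpNorm f 2 volume = ENNReal.ofReal ‖f‖ := by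
  rw [Lp.norm_def, ENNReal.ofReal_toReal (Lp.eLpNorm_ne_top f)]

/-- The L¹ factors are bounded by the energy norm. In the weighted factors w_s/e · 1/w_s = 1/e ≤ 1,
which leaves the plain norm. So only one factor ever carries the H^s norm, which keeps growth linear
once the energy is fixed. -/
lemma exists_eLpNorm_bilinFun_le (hγ : 0 < γ) (hs : 1 ≤ s) : ∃ C : ℝ, 0 ≤ C ∧ ∀ g h : L2C,
    eLpNorm (bilinFun γ s g h) 2 volume ≤ ENNReal.ofReal
      (C * (‖g‖ * ‖mulL (energyRatio γ s) h‖ + ‖mulL (energyRatio γ s) g‖ * ‖h‖)) := by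
  obtain ⟨C, hC0, hC⟩ := exists_eLpNorm_weight_conv_le hγ hs
  set I := (eLpNorm (fun ξ => ((energyWeight γ ξ)⁻¹ : ℂ)) 2 volume).toReal with hI
  have hI' : eLpNorm (fun ξ => ((energyWeight γ ξ)⁻¹ : ℂ)) 2 volume = ENNReal.ofReal I :=
    (ENNReal.ofReal_toReal (memLp_inv_energyWeight hγ).eLpNorm_ne_top).symm
  have hI0 : 0 ≤ I := ENNReal.toReal_nonneg
  have h1 : ∀ g : L2C, eLpNorm (mulL (invWeight s) g) 1 volume ≤
      ENNReal.ofReal (I * ‖mulL (energyRatio γ s) g‖) := fun g => by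
    refine (eLpNorm_invWeight_one_le hγ hs g).trans_eq ?_
    rw [hI', eLpNorm_eq_ofReal, ENNReal.ofReal_mul hI0]
  have h2 : ∀ g : L2C, eLpNorm (fun ξ => (sobolevWeight s ξ / energyWeight γ ξ : ℝ) *
      (mulL (invWeight s) g : ℝ → ℂ) ξ) 2 volume ≤ ENNReal.ofReal ‖g‖ := fun g => by
    rw [← eLpNorm_eq_ofReal]
    refine eLpNorm_mono_ae ?_
    filter_upwards [mulL_coe (isMultiplier_invWeight (s := s) (by linarith)) g] with ξ h
    have hw := sobolevWeight_pos s ξ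
    have he := energyWeight_pos hγ ξ
    rw [h, invWeight, ← mul_assoc, ← Complex.ofReal_mul, norm_mul, Complex.norm_real,
      Real.norm_eq_abs, abs_of_pos (by positivity)]
    refine mul_le_of_le_one_left (norm_nonneg _) ?_
    have : sobolevWeight s ξ / energyWeight γ ξ * (sobolevWeight s ξ)⁻¹ = (energyWeight γ ξ)⁻¹ := by
      field_simp
    rw [this]
    exact inv_le_one_of_one_le₀ (one_le_energyWeight hγ ξ)
  refine ⟨C * I, by positivity, fun g h => ?_⟩
  refine (hC _ _ (measurable_Lp _) (measurable_Lp _)).trans ?_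
  calc _ ≤ ENNReal.ofReal C * (ENNReal.ofReal ‖g‖ * ENNReal.ofReal (I * ‖mulL (energyRatio γ s) h‖)
        + ENNReal.ofReal (I * ‖mulL (energyRatio γ s) g‖) * ENNReal.ofReal ‖h‖) := by
        gcongr
        · exact h2 g
        · exact h1 h
        · exact h1 g
        · exact h2 h
    _ = _ := by
        rw [← ENNReal.ofReal_mul (by positivity), ← ENNReal.ofReal_mul (by positivity),
          ← ENNReal.ofReal_add (by positivity) (by positivity), ← ENNReal.ofReal_mul hC0]
        congr 1
        ring

lemma memLp_bilinFun (hγ : 0 < γ) (hs : 1 ≤ s) (g h : L2C) :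
    MemLp (bilinFun γ s g h) 2 volume := by
  obtain ⟨C, -, hC⟩ := exists_eLpNorm_bilinFun_le hγ hs
  exact ⟨(measurable_bilinFun hγ s g h).aestronglyMeasurable,
    (hC g h).trans_lt ENNReal.ofReal_lt_top⟩

open Classical in
/-- The nonlinearity as a bilinear operation on `L²` (zero for parameters outside its range). -/
noncomputable def bilin (γ s : ℝ) (g h : L2C) : L2C :=
  if H : MemLp (bilinFun γ s g h) 2 volume then H.toLp _ else 0

lemma bilin_coe (hγ : 0 < γ) (hs : 1 ≤ s) (g h : L2C) :
    bilin γ s g h =ᵐ[volume] bilinFun γ s g h := by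
  rw [bilin, dif_pos (memLp_bilinFun hγ hs g h)]
  exact MemLp.coeFn_toLp _

lemma exists_norm_bilin_le (hγ : 0 < γ) (hs : 1 ≤ s) : ∃ C : ℝ, 0 ≤ C ∧ ∀ g h : L2C,
    ‖bilin γ s g h‖ ≤
      C * (‖g‖ * ‖mulL (energyRatio γ s) h‖ + ‖mulL (energyRatio γ s) g‖ * ‖h‖) := by
  obtain ⟨C, hC0, hC⟩ := exists_eLpNorm_bilinFun_le hγ hs
  refine ⟨C, hC0, fun g h => ?_⟩
  rw [Lp.norm_def, eLpNorm_congr_ae (bilin_coe hγ hs g h)]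
  exact ENNReal.toReal_le_of_le_ofReal (by positivity) (hC g h)

lemma bilin_comm (γ s : ℝ) (g h : L2C) : bilin γ s g h = bilin γ s h g := by
  have : bilinFun γ s g h = bilinFun γ s h g := by
    ext ξ
    rw [bilinFun, conv_comm, bilinFun]
  unfold bilin
  generalize bilinFun γ s g h = F at this ⊢
  subst this
  rfl

lemma bilin_sub_left (hγ : 0 < γ) (hs : 1 ≤ s) (g g' h : L2C) :
    bilin γ s (g - g') h = bilin γ s g h - bilin γ s g' h := by
  ext1
  filter_upwards [bilin_coe hγ hs (g - g') h, bilin_coe hγ hs g h, bilin_coe hγ hs g' h,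
    Lp.coeFn_sub (bilin γ s g h) (bilin γ s g' h)] with ξ h1 h2 h3 h4
  rw [h1, h4, Pi.sub_apply, h2, h3, bilinFun, bilinFun, bilinFun, map_sub,
    conv_congr_left (Lp.coeFn_sub _ _), conv_sub_left (Lp.memLp _) (Lp.memLp _) (Lp.memLp _),
    Pi.sub_apply, mul_sub]

/-- By symmetry the difference can be put in the first slot of both terms, the slot measured in the
weak norm by `exists_norm_invWeight_bilin_le`. -/
lemma bilin_self_sub (hγ : 0 < γ) (hs : 1 ≤ s) (g h : L2C) :
    bilin γ s g g - bilin γ s h h = bilin γ s (g - h) g + bilin γ s (g - h) h := by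
  rw [bilin_sub_left hγ hs, bilin_sub_left hγ hs, bilin_comm γ s h g]
  abel

lemma bilin_zero (hγ : 0 < γ) (hs : 1 ≤ s) (h : L2C) : bilin γ s 0 h = 0 := by
  simpa using bilin_sub_left hγ hs 0 0 h

/-- The tame estimate with the energy norm bounded by the H^s norm, as s ≥ 1 permits; it gives the
local Lipschitz constant. -/
lemma exists_norm_bilin_le_mul (hγ : 0 < γ) (hs : 1 ≤ s) : ∃ C : ℝ, 0 ≤ C ∧ ∀ g h : L2C,
    ‖bilin γ s g h‖ ≤ C * (‖g‖ * ‖h‖) := by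
  obtain ⟨C, hC0, hC⟩ := exists_norm_bilin_le hγ hs
  refine ⟨2 * C * √(1 + γ), by positivity, fun g h => (hC g h).trans ?_⟩
  have hA := isMultiplier_energyRatio hγ hs
  have e1 := norm_mulL_le hA (norm_energyRatio_le hγ hs) g
  have e2 := norm_mulL_le hA (norm_energyRatio_le hγ hs) h
  calc _ ≤ C * (‖g‖ * (√(1 + γ) * ‖h‖) + (√(1 + γ) * ‖g‖) * ‖h‖) := by gcongr
    _ = _ := by ring

lemma continuous_bilin_self (hγ : 0 < γ) (hs : 1 ≤ s) : Continuous fun g => bilin γ s g g := by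
  obtain ⟨C, hC0, hC⟩ := exists_norm_bilin_le_mul hγ hs
  rw [continuous_iff_continuousAt]
  intro g₀
  rw [ContinuousAt, tendsto_iff_norm_sub_tendsto_zero]
  have h1 : Continuous fun g : L2C => C * (‖g - g₀‖ * ‖g‖) + C * (‖g - g₀‖ * ‖g₀‖) := by fun_prop
  have h2 := h1.tendsto g₀
  simp only [sub_self, norm_zero, zero_mul, mul_zero, add_zero] at h2
  refine squeeze_zero (fun _ => norm_nonneg _) (fun g => ?_) h2
  rw [bilin_self_sub hγ hs]
  exact (norm_add_le _ _).trans (add_le_add (hC _ _) (hC _ _))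

/-- The `L²` estimate for the nonlinearity. -/
lemma exists_norm_invWeight_bilin_le (hγ : 0 < γ) (hs : 1 ≤ s) : ∃ C : ℝ, 0 ≤ C ∧ ∀ g h : L2C,
    ‖mulL (invWeight s) (bilin γ s g h)‖ ≤ C * ‖mulL (invWeight s) g‖ * ‖h‖ := by
  set I := (eLpNorm (fun ξ => ((energyWeight γ ξ)⁻¹ : ℂ)) 2 volume).toReal with hI
  have hI' : eLpNorm (fun ξ => ((energyWeight γ ξ)⁻¹ : ℂ)) 2 volume = ENNReal.ofReal I :=
    (ENNReal.ofReal_toReal (memLp_inv_energyWeight hγ).eLpNorm_ne_top).symm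
  have hI0 : 0 ≤ I := ENNReal.toReal_nonneg
  have hγ1 : 0 ≤ 3 / 4 / √γ := by positivity
  refine ⟨3 / 4 / √γ * (I * √(1 + γ)), by positivity, fun g h => ?_⟩
  have h1 : eLpNorm (mulL (invWeight s) (bilin γ s g h)) 2 volume ≤ ENNReal.ofReal (3 / 4 / √γ) *
      eLpNorm (conv (mulL (invWeight s) g) (mulL (invWeight s) h)) 2 volume := by
    refine eLpNorm_le_mul_eLpNorm_of_ae_le_mul ?_ 2
    filter_upwards [mulL_coe (isMultiplier_invWeight (s := s) (by linarith)) (bilin γ s g h),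
      bilin_coe hγ hs g h] with ξ e1 e2
    have hw : (sobolevWeight s ξ : ℂ) ≠ 0 := by exact_mod_cast (sobolevWeight_pos s ξ).ne'
    rw [e1, e2, invWeight, bilinFun, Complex.ofReal_inv, mul_assoc, inv_mul_cancel_left₀ hw,
      norm_mul]
    exact mul_le_mul_of_nonneg_right (norm_nonlinSymbol_le' hγ ξ) (norm_nonneg _)
  have h2 : eLpNorm (mulL (invWeight s) h) 1 volume ≤ ENNReal.ofReal (I * (√(1 + γ) * ‖h‖)) := by
    refine (eLpNorm_invWeight_one_le hγ hs h).trans ?_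
    rw [hI', eLpNorm_eq_ofReal, ENNReal.ofReal_mul hI0]
    gcongr
    exact norm_mulL_le (isMultiplier_energyRatio hγ hs) (norm_energyRatio_le hγ hs) h
  rw [Lp.norm_def]
  refine ENNReal.toReal_le_of_le_ofReal (by positivity) (h1.trans ?_)
  -- Young is applied with h in L¹ and g in L², so that g, later a difference of solutions, is
  -- measured only in L².
  rw [conv_comm]
  calc _ ≤ ENNReal.ofReal (3 / 4 / √γ) * (ENNReal.ofReal (I * (√(1 + γ) * ‖h‖)) *
        ENNReal.ofReal ‖mulL (invWeight s) g‖) := by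
        gcongr
        refine (eLpNorm_conv_le (measurable_Lp _) (measurable_Lp _)).trans ?_
        rw [eLpNorm_eq_ofReal]
        gcongr
    _ = _ := by
        rw [← ENNReal.ofReal_mul (by positivity), ← ENNReal.ofReal_mul (by positivity)]
        congr 1
        ring

end Bilinear

/-! ### Reality of the solution and conservation of energy -/

section Hermitian

variable {γ ν s : ℝ}

/-- Reflection `g ↦ g(-·)` on `L²`. -/
noncomputable def reflL : L2C →ₗᵢ[ℝ] L2C :=
  Lp.compMeasurePreservingₗᵢ ℝ Neg.neg (Measure.measurePreserving_neg (volume : Measure ℝ))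

/-- Complex conjugation on `L²`. -/
noncomputable def conjL : L2C →L[ℝ] L2C :=
  (Complex.conjCLE : ℂ →L[ℝ] ℂ).compLpL 2 volume

lemma reflL_coe (g : L2C) : reflL g =ᵐ[volume] fun ξ => g (-ξ) :=
  Lp.coeFn_compMeasurePreserving g (Measure.measurePreserving_neg (volume : Measure ℝ))

lemma conjL_coe (g : L2C) : conjL g =ᵐ[volume] fun ξ => star (g ξ) :=
  ContinuousLinearMap.coeFn_compLpL _ g

/-- The functions `g ∈ L²` with `g(-ξ) = conj g(ξ)`: the Fourier transforms of real functions. -/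
noncomputable def hermitian : Submodule ℝ L2C :=
  LinearMap.eqLocus reflL.toLinearMap (conjL : L2C →ₗ[ℝ] L2C)

lemma mem_hermitian_iff {g : L2C} :
    g ∈ hermitian ↔ (fun ξ => g (-ξ)) =ᵐ[volume] fun ξ => star (g ξ) := by
  have h : g ∈ hermitian ↔ reflL g = conjL g := Iff.rfl
  rw [h, Lp.ext_iff]
  constructor
  · intro h
    exact (reflL_coe g).symm.trans (h.trans (conjL_coe g))
  · intro h
    exact (reflL_coe g).trans (h.trans (conjL_coe g).symm)

lemma isClosed_hermitian : IsClosed (hermitian : Set L2C) :=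
  isClosed_eq reflL.continuous conjL.continuous

/-- Picard–Lindelöf is applied in this space, on which the energy identity holds. -/
noncomputable instance : CompleteSpace hermitian := isClosed_hermitian.completeSpace_coe

lemma mulL_mem_hermitian {φ : ℝ → ℂ} (hφ : IsMultiplier φ) (h : ∀ ξ, φ (-ξ) = star (φ ξ)) {g : L2C}
    (hg : g ∈ hermitian) : mulL φ g ∈ hermitian := by
  rw [mem_hermitian_iff] at hg ⊢
  have h1 := mulL_coe hφ g
  filter_upwards [h1, hg,
    (Measure.measurePreserving_neg (volume : Measure ℝ)).quasiMeasurePreserving.ae_eq_comp h1]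
    with ξ e1 e2 e3
  simp only [Function.comp_apply] at e3
  rw [e3, e1, e2, h, star_mul']

lemma invWeight_neg (s ξ : ℝ) : invWeight s (-ξ) = star (invWeight s ξ) := by
  simp [invWeight, sobolevWeight_neg, Complex.conj_ofReal]

/-- The product of real functions is real, and the symbols w_s and m are themselves Hermitian. -/
lemma bilin_mem_hermitian (hγ : 0 < γ) (hs : 1 ≤ s) {g h : L2C} (hg : g ∈ hermitian)
    (hh : h ∈ hermitian) : bilin γ s g h ∈ hermitian := by
  have hI := isMultiplier_invWeight (s := s) (by linarith)
  have hg' := mem_hermitian_iff.1 (mulL_mem_hermitian hI (invWeight_neg s) hg)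
  have hh' := mem_hermitian_iff.1 (mulL_mem_hermitian hI (invWeight_neg s) hh)
  rw [mem_hermitian_iff]
  have h1 := bilin_coe hγ hs g h
  filter_upwards [h1,
    (Measure.measurePreserving_neg (volume : Measure ℝ)).quasiMeasurePreserving.ae_eq_comp h1]
    with ξ e1 e2
  simp only [Function.comp_apply] at e2
  rw [e1, e2, bilinFun, bilinFun, conv_neg_eq_star hg' hh', sobolevWeight_neg, nonlinSymbol_neg,
    star_mul', star_mul', RCLike.star_def, Complex.conj_ofReal]

/-- `∫ ∂ₓ(u²) u = 0` on the Fourier side. -/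
lemma integral_mul_conv_eq_zero {f : ℝ → ℂ} (hf : Measurable f) (h1 : MemLp f 1 volume)
    (h2 : MemLp f 2 volume) (h3 : MemLp (fun ξ : ℝ => (ξ : ℂ) * f ξ) 2 volume) :
    ∫ ξ : ℝ, (ξ : ℂ) * f (-ξ) * conv f f ξ = 0 := by
  set F : ℝ → ℝ → ℂ := fun ξ η => (ξ : ℂ) * f (-ξ) * (f η * f (ξ - η)) with hF
  set G : ℝ → ℝ → ℂ := fun ξ η => (η : ℂ) * f (-ξ) * (f η * f (ξ - η)) with hG
  have hFm : Measurable (Function.uncurry F) := by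
    simp only [hF]; unfold Function.uncurry; fun_prop
  have hconv : MemLp (lconv (fun η => ‖f η‖ₑ) (fun η => ‖f η‖ₑ)) 2 volume := by
    refine ⟨(measurable_lconv hf.enorm hf.enorm).aestronglyMeasurable,
      (eLpNorm_lconv_le hf.enorm hf.enorm).trans_lt ?_⟩
    rw [eLpNorm_enorm, eLpNorm_enorm]
    exact ENNReal.mul_lt_top h1.eLpNorm_lt_top h2.eLpNorm_lt_top
  -- Fubini is legitimate because ξ f(-ξ) is in L² and |f| * |f| is in L² by Young.
  have hFi : Integrable (Function.uncurry F) (volume.prod volume) := by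
    refine ⟨hFm.aestronglyMeasurable, ?_⟩
    rw [hasFiniteIntegral_iff_enorm, lintegral_prod _ hFm.enorm.aemeasurable]
    have e : ∀ ξ, ∫⁻ η, ‖Function.uncurry F (ξ, η)‖ₑ =
        ‖(ξ : ℂ) * f (-ξ)‖ₑ * lconv (fun η => ‖f η‖ₑ) (fun η => ‖f η‖ₑ) ξ := by
      intro ξ
      rw [lconv, ← lintegral_const_mul _ (by fun_prop)]
      simp only [Function.uncurry, hF, enorm_mul]
    simp only [e]
    have h4 : MemLp (fun ξ : ℝ => ‖(ξ : ℂ) * f (-ξ)‖ₑ) 2 volume := by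
      refine MemLp.enorm ?_
      have := (h3.comp_measurePreserving (Measure.measurePreserving_neg volume)).neg
      refine this.congr_norm (Measurable.aestronglyMeasurable (by fun_prop)) (.of_forall fun ξ => ?_)
      simp
    have e2 : ∀ p : ℝ → ℝ≥0∞, eLpNorm p 2 volume = (∫⁻ ξ, p ξ ^ (2 : ℝ)) ^ (1 / 2 : ℝ) := fun p => by
      rw [eLpNorm_eq_lintegral_rpow_enorm_toReal (by norm_num) (by norm_num)]
      simp
    have h5 := ENNReal.lintegral_mul_le_Lp_mul_Lq (volume : Measure ℝ)
      Real.HolderConjugate.two_two h4.1.aemeasurable hconv.1.aemeasurable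
    rw [← e2, ← e2] at h5
    exact h5.trans_lt (ENNReal.mul_lt_top h4.eLpNorm_lt_top hconv.eLpNorm_lt_top)
  have hneg : MeasurePreserving (Prod.map Neg.neg Neg.neg : ℝ × ℝ → ℝ × ℝ)
      ((volume : Measure ℝ).prod volume)
      ((volume : Measure ℝ).prod volume) :=
    (Measure.measurePreserving_neg volume).prod (Measure.measurePreserving_neg volume)
  have hFneg := (hneg.integrable_comp hFi.aestronglyMeasurable).2 hFi
  -- The form is symmetric in the frequencies -ξ, η, ξ - η. The change (ξ, η) ↦ (-η, -ξ) exchanges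
  -- the first two and turns the factor ξ into -η.
  have hswap : ∫ ξ, ∫ η, F ξ η = ∫ ξ, ∫ η, -G ξ η := by
    rw [← integral_neg_eq_self]
    have : ∀ ξ, ∫ η, F (-ξ) η = ∫ η, F (-ξ) (-η) := fun ξ => (integral_neg_eq_self _ _).symm
    simp only [this]
    rw [integral_integral_swap]
    · refine integral_congr_ae (.of_forall fun ξ => integral_congr_ae (.of_forall fun η => ?_))
      simp only [hF, hG, neg_neg, Complex.ofReal_neg, neg_add_eq_sub, sub_neg_eq_add]
      ring
    · exact hFneg
  have hGi : Integrable (Function.uncurry G) (volume.prod volume) := by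
    refine hFneg.swap.neg.congr (.of_forall fun z => ?_)
    simp only [hF, hG, Function.comp_apply, Pi.neg_apply, Function.uncurry, Prod.map_fst,
      Prod.map_snd, Prod.fst_swap, Prod.snd_swap, neg_neg, Complex.ofReal_neg, neg_add_eq_sub,
      sub_neg_eq_add]
    ring
  -- The change η ↦ ξ - η exchanges the other two, and η + (ξ - η) = ξ.
  have hrefl : ∫ ξ, ∫ η, F ξ η = ∫ ξ, ((∫ η, G ξ η) + ∫ η, G ξ η) := by
    refine integral_congr_ae ?_
    filter_upwards [hGi.prod_right_ae] with ξ hξ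
    change Integrable (G ξ) volume at hξ
    have e1 : ∫ η, G ξ η = ∫ η, G ξ (ξ - η) := (integral_sub_left_eq_self _ _ ξ).symm
    have e2 : Integrable fun η => G ξ (ξ - η) := hξ.comp_sub_left ξ
    nth_rw 1 [e1]
    rw [← integral_add e2 hξ]
    refine integral_congr_ae (.of_forall fun η => ?_)
    simp only [hF, hG, sub_sub_cancel, Complex.ofReal_sub]
    ring
  have hI : ∫ ξ : ℝ, (ξ : ℂ) * f (-ξ) * conv f f ξ = ∫ ξ, ∫ η, F ξ η := by
    refine integral_congr_ae (.of_forall fun ξ => ?_)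
    simp only [hF, conv, integral_const_mul]
  have hGi' : Integrable fun ξ => ∫ η, G ξ η := hGi.integral_prod_left
  rw [integral_add hGi' hGi'] at hrefl
  simp only [integral_neg] at hswap
  rw [hI]
  -- With J and K the integrals of F and G, J = -K and J = 2K force J = 0.
  linear_combination (1 / 3 : ℂ) * hrefl + (2 / 3 : ℂ) * hswap

lemma memLp_one_invWeight (hγ : 0 < γ) (hs : 1 ≤ s) (g : L2C) :
    MemLp (mulL (invWeight s) g) 1 volume :=
  ⟨Lp.aestronglyMeasurable _, (eLpNorm_invWeight_one_le hγ hs g).trans_lt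
    (ENNReal.mul_lt_top (memLp_inv_energyWeight hγ).eLpNorm_lt_top (Lp.eLpNorm_lt_top _))⟩

/-- The nonlinearity does not change the energy. -/
lemma inner_energyRatio_bilin_eq_zero (hγ : 0 < γ) (hs : 1 ≤ s) {g : L2C} (hg : g ∈ hermitian) :
    inner ℝ (mulL (energyRatio γ s) g) (mulL (energyRatio γ s) (bilin γ s g g)) = 0 := by
  have hI := isMultiplier_invWeight (s := s) (by linarith)
  have hA := isMultiplier_energyRatio hγ hs
  set f := mulL (invWeight s) g with hf
  have hfh : f ∈ hermitian := mulL_mem_hermitian hI (invWeight_neg s) hg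
  have hfA : (mulL (energyRatio γ s) g : ℝ → ℂ) =ᵐ[volume] fun ξ => (energyWeight γ ξ : ℂ) * f ξ := by
    filter_upwards [mulL_coe hA g, mulL_coe hI g] with ξ h1 h2
    rw [h1, hf, h2, energyRatio, invWeight]
    push_cast
    ring
  have h3 : MemLp (fun ξ : ℝ => (ξ : ℂ) * f ξ) 2 volume := by
    refine (Lp.memLp (mulL (energyRatio γ s) g)).of_le_mul (c := 1 / √γ / (2 * Real.pi))
      (Measurable.aestronglyMeasurable ?_) ?_
    · have := measurable_Lp f
      fun_prop
    · filter_upwards [hfA] with ξ h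
      have he := energyWeight_pos hγ ξ
      rw [h, norm_mul, norm_mul, Complex.norm_real, Complex.norm_real, Real.norm_eq_abs,
        Real.norm_eq_abs, abs_of_pos he, ← mul_assoc]
      refine mul_le_mul_of_nonneg_right ?_ (norm_nonneg _)
      have := abs_freq_le hγ ξ
      rw [abs_mul, abs_of_pos (by positivity : (0 : ℝ) < 2 * Real.pi)] at this
      calc |ξ| = 2 * Real.pi * |ξ| / (2 * Real.pi) := by field_simp
        _ ≤ (energyWeight γ ξ / √γ) / (2 * Real.pi) := by gcongr
        _ = _ := by ring
  have key := integral_mul_conv_eq_zero (measurable_Lp f) (memLp_one_invWeight hγ hs g)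
    (Lp.memLp f) h3
  -- The energy is chosen so that e² m = -(3/4) iκ: its weight cancels the denominator of the
  -- symbol. Hermitian symmetry turns the conjugate of f(ξ) into f(-ξ).
  have h4 : inner ℂ (mulL (energyRatio γ s) g) (mulL (energyRatio γ s) (bilin γ s g g)) =
      ∫ ξ : ℝ, -(3 / 4) * (Complex.I * (2 * Real.pi)) * ((ξ : ℂ) * f (-ξ) * conv f f ξ) := by
    rw [L2.inner_def]
    refine integral_congr_ae ?_
    filter_upwards [hfA, mulL_coe hA (bilin γ s g g), bilin_coe hγ hs g g,
      mem_hermitian_iff.1 hfh] with ξ e1 e2 e3 e4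
    have hw : (sobolevWeight s ξ : ℂ) ≠ 0 := by exact_mod_cast (sobolevWeight_pos s ξ).ne'
    have he : ((energyWeight γ ξ : ℂ)) ^ 2 = 1 + γ * (2 * Real.pi * ξ) ^ 2 := by
      exact_mod_cast sq_energyWeight hγ ξ
    have hne : (1 + γ * (2 * Real.pi * ξ) ^ 2 : ℂ) ≠ 0 := by
      rw [← he]
      exact pow_ne_zero _ (by exact_mod_cast (energyWeight_pos hγ ξ).ne')
    have hm : (energyWeight γ ξ : ℂ) ^ 2 * nonlinSymbol γ ξ
        = -(3 / 4) * (Complex.I * (2 * Real.pi * ξ)) := by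
      rw [he, nonlinSymbol, mul_div_assoc', mul_div_cancel_left₀ _ hne]
    rw [e1, e2, e3, e4, energyRatio, bilinFun, ← hf, RCLike.inner_apply, map_mul,
      Complex.conj_ofReal, RCLike.star_def, Complex.ofReal_mul, Complex.ofReal_inv]
    calc _ = ((sobolevWeight s ξ : ℂ)⁻¹ * sobolevWeight s ξ) *
          (((energyWeight γ ξ : ℂ) ^ 2 * nonlinSymbol γ ξ) *
            (conv f f ξ * (starRingEnd ℂ) (f ξ))) := by ring
      _ = _ := by
        rw [inv_mul_cancel₀ hw, hm]
        ring
  rw [real_inner_eq_re_inner, h4, integral_const_mul, key, mul_zero, Complex.zero_re]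

end Hermitian

/-! ### The linear group and the interaction picture -/

section Group

variable {γ ν s : ℝ}

/-- The symbol `exp(i t λ(ξ))` of the linear evolution. -/
noncomputable def evolSymbol (γ ν t ξ : ℝ) : ℂ := Complex.exp (Complex.I * ((t * phase γ ν ξ : ℝ) : ℂ))

lemma norm_evolSymbol (γ ν t ξ : ℝ) : ‖evolSymbol γ ν t ξ‖ = 1 := by
  rw [evolSymbol, mul_comm, Complex.norm_exp_ofReal_mul_I]

lemma isMultiplier_evolSymbol (hγ : 0 < γ) (ν t : ℝ) : IsMultiplier (evolSymbol γ ν t) := by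
  refine ⟨?_, 1, fun ξ => (norm_evolSymbol γ ν t ξ).le⟩
  have := (continuous_phase hγ ν).measurable
  unfold evolSymbol
  fun_prop

lemma star_evolSymbol (γ ν t ξ : ℝ) : star (evolSymbol γ ν t ξ) = evolSymbol γ ν (-t) ξ := by
  rw [evolSymbol, evolSymbol, RCLike.star_def, ← Complex.exp_conj, map_mul, Complex.conj_I,
    Complex.conj_ofReal]
  congr 1
  push_cast
  ring

lemma evolSymbol_add (γ ν t t' ξ : ℝ) :
    evolSymbol γ ν (t + t') ξ = evolSymbol γ ν t ξ * evolSymbol γ ν t' ξ := by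
  rw [evolSymbol, evolSymbol, evolSymbol, ← Complex.exp_add]
  congr 1
  push_cast
  ring

lemma evolSymbol_zero (γ ν ξ : ℝ) : evolSymbol γ ν 0 ξ = 1 := by simp [evolSymbol]

lemma evolSymbol_neg (γ ν t ξ : ℝ) : evolSymbol γ ν t (-ξ) = star (evolSymbol γ ν t ξ) := by
  rw [star_evolSymbol, evolSymbol, evolSymbol, phase_neg]
  congr 3
  ring

/-- The linear evolution on the Fourier side. -/
noncomputable def evol (γ ν t : ℝ) : L2C →L[ℂ] L2C := mulL (evolSymbol γ ν t)

lemma norm_evol (hγ : 0 < γ) (ν t : ℝ) (g : L2C) : ‖evol γ ν t g‖ = ‖g‖ :=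
  norm_mulL_eq (isMultiplier_evolSymbol hγ ν t) (norm_evolSymbol γ ν t) g

lemma evol_coe (hγ : 0 < γ) (ν t : ℝ) (g : L2C) :
    evol γ ν t g =ᵐ[volume] fun ξ => evolSymbol γ ν t ξ * g ξ :=
  mulL_coe (isMultiplier_evolSymbol hγ ν t) g

lemma evol_neg_evol (hγ : 0 < γ) (ν t : ℝ) (g : L2C) : evol γ ν (-t) (evol γ ν t g) = g := by
  ext1
  filter_upwards [evol_coe hγ ν (-t) (evol γ ν t g), evol_coe hγ ν t g] with ξ h1 h2
  rw [h1, h2, ← mul_assoc, ← evolSymbol_add, neg_add_cancel, evolSymbol_zero, one_mul]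

lemma evol_evol_neg (hγ : 0 < γ) (ν t : ℝ) (g : L2C) : evol γ ν t (evol γ ν (-t) g) = g := by
  simpa using evol_neg_evol hγ ν (-t) g

lemma evol_zero (hγ : 0 < γ) (ν : ℝ) (g : L2C) : evol γ ν 0 g = g := by
  ext1
  filter_upwards [evol_coe hγ ν 0 g] with ξ h1
  rw [h1, evolSymbol_zero, one_mul]

lemma evol_mem_hermitian (hγ : 0 < γ) (ν t : ℝ) {g : L2C} (hg : g ∈ hermitian) :
    evol γ ν t g ∈ hermitian :=
  mulL_mem_hermitian (isMultiplier_evolSymbol hγ ν t) (evolSymbol_neg γ ν t) hg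

lemma inner_evol_left (hγ : 0 < γ) (ν t : ℝ) (f g : L2C) :
    inner ℂ (evol γ ν t f) g = inner ℂ f (evol γ ν (-t) g) := by
  have h : (fun ξ => star (evolSymbol γ ν t ξ)) = evolSymbol γ ν (-t) :=
    funext (star_evolSymbol γ ν t)
  have := inner_mulL_left (isMultiplier_evolSymbol hγ ν t)
    (by rw [h]; exact isMultiplier_evolSymbol hγ ν (-t)) f g
  rwa [h] at this

/-- The phase may be unbounded, so only strong continuity can be expected. For an isometric group
the squared distance is 2‖g‖² - 2 Re⟨g, S(t₀ - t)g⟩, so weak continuity is enough, and that is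
dominated convergence. -/
lemma continuous_evol_apply (hγ : 0 < γ) (ν : ℝ) (g : L2C) : Continuous fun t => evol γ ν t g := by
  have hinner : Continuous fun t => inner ℂ g (evol γ ν t g) := by
    have e : (fun t => inner ℂ g (evol γ ν t g)) = fun t => ∫ ξ, evolSymbol γ ν t ξ * inner ℂ (g ξ) (g ξ) := by
      ext t
      rw [L2.inner_def]
      refine integral_congr_ae ?_
      filter_upwards [evol_coe hγ ν t g] with ξ h
      rw [h, ← smul_eq_mul (evolSymbol γ ν t ξ), inner_smul_right]
    rw [e]
    have hint := L2.integrable_inner (𝕜 := ℂ) g g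
    refine continuous_of_dominated (bound := fun ξ => ‖inner ℂ (g ξ) (g ξ)‖) (fun t => ?_)
      (fun t => .of_forall fun ξ => ?_) hint.norm (.of_forall fun ξ => ?_)
    · exact (isMultiplier_evolSymbol hγ ν t).measurable.aestronglyMeasurable.mul
        hint.aestronglyMeasurable
    · rw [norm_mul, norm_evolSymbol, one_mul]
    · unfold evolSymbol
      fun_prop
  rw [continuous_iff_continuousAt]
  intro t₀
  rw [ContinuousAt, tendsto_iff_norm_sub_tendsto_zero]
  have e : ∀ t, ‖evol γ ν t g - evol γ ν t₀ g‖ ^ 2 =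
      2 * ‖g‖ ^ 2 - 2 * (inner ℂ g (evol γ ν (t₀ - t) g)).re := by
    intro t
    have h1 : inner ℂ (evol γ ν t g) (evol γ ν t₀ g) = inner ℂ g (evol γ ν (t₀ - t) g) := by
      rw [inner_evol_left hγ]
      congr 1
      rw [evol, evol, evol, mulL_mulL (isMultiplier_evolSymbol hγ ν _) (isMultiplier_evolSymbol hγ ν _)]
      simp_rw [← evolSymbol_add, neg_add_eq_sub]
    rw [norm_sub_sq (𝕜 := ℂ), norm_evol hγ, norm_evol hγ, h1]
    simp only [RCLike.re_eq_complex_re]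
    ring
  have h2 : Filter.Tendsto (fun t => ‖evol γ ν t g - evol γ ν t₀ g‖ ^ 2) (𝓝 t₀) (𝓝 0) := by
    simp only [e]
    have h3 : Continuous fun t => 2 * ‖g‖ ^ 2 - 2 * (inner ℂ g (evol γ ν (t₀ - t) g)).re :=
      continuous_const.sub (continuous_const.mul
        (Complex.continuous_re.comp (hinner.comp (by fun_prop))))
    have h4 := h3.tendsto t₀
    rwa [sub_self, evol_zero hγ, ← RCLike.re_eq_complex_re, inner_self_eq_norm_sq, sub_self] at h4
  have h5 := (Real.continuous_sqrt.tendsto 0).comp h2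
  rw [Real.sqrt_zero] at h5
  refine h5.congr fun t => ?_
  rw [Function.comp_apply, Real.sqrt_sq (norm_nonneg _)]

/-- Isometry absorbs the variation of g, leaving strong continuity at the fixed vector g x₀. -/
lemma continuous_evol_comp {X : Type*} [TopologicalSpace X] (hγ : 0 < γ) (ν : ℝ) {τ : X → ℝ}
    {g : X → L2C} {S : Set X} (hτ : ContinuousOn τ S) (hg : ContinuousOn g S) :
    ContinuousOn (fun x => evol γ ν (τ x) (g x)) S := by
  intro x₀ hx₀
  rw [ContinuousWithinAt, tendsto_iff_norm_sub_tendsto_zero]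
  have h1 := tendsto_iff_norm_sub_tendsto_zero.1 (hg x₀ hx₀)
  have h2 := tendsto_iff_norm_sub_tendsto_zero.1
    (((continuous_evol_apply hγ ν (g x₀)).tendsto (τ x₀)).comp (hτ x₀ hx₀))
  have h3 := h1.add h2
  rw [add_zero] at h3
  refine squeeze_zero (fun _ => norm_nonneg _) (fun x => ?_) h3
  have : evol γ ν (τ x) (g x) - evol γ ν (τ x₀) (g x₀) =
      evol γ ν (τ x) (g x - g x₀) + (evol γ ν (τ x) (g x₀) - evol γ ν (τ x₀) (g x₀)) := by
    rw [map_sub]; abel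
  rw [this]
  refine (norm_add_le _ _).trans_eq ?_
  rw [norm_evol hγ]
  rfl

/-- The equation in the interaction picture: `a = exp(-i t λ) w_s û` satisfies `a' = field t a`. -/
noncomputable def field (hγ : 0 < γ) (hs : 1 ≤ s) (ν t : ℝ) (a : hermitian) : hermitian :=
  ⟨evol γ ν (-t) (bilin γ s (evol γ ν t a) (evol γ ν t a)),
    evol_mem_hermitian hγ ν _ (bilin_mem_hermitian hγ hs (evol_mem_hermitian hγ ν t a.2)
      (evol_mem_hermitian hγ ν t a.2))⟩

/-- Multiplication by `e / w_s`, as a real operator on the Hermitian functions. -/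
noncomputable def energyL (γ s : ℝ) : hermitian →L[ℝ] L2C :=
  ((mulL (energyRatio γ s)).restrictScalars ℝ).comp hermitian.subtypeL

/-- The group is isometric and commutes with the energy multiplier, so conjugating by it preserves
every bound on the nonlinearity and the energy identity. -/
lemma exists_tameField (hγ : 0 < γ) (hs : 1 ≤ s) (ν : ℝ) :
    ∃ K C, TameField (field hγ hs ν) (energyL γ s) K C := by
  obtain ⟨C, hC0, hC⟩ := exists_norm_bilin_le hγ hs
  have hA := isMultiplier_energyRatio hγ hs
  have hcomm : ∀ t g, mulL (energyRatio γ s) (evol γ ν t g) = evol γ ν t (mulL (energyRatio γ s) g) :=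
    fun t g => mulL_comm hA (isMultiplier_evolSymbol hγ ν t) g
  obtain ⟨D, hD0, hb⟩ := exists_norm_bilin_le_mul hγ hs
  -- The two terms of the tame estimate coincide on the diagonal, hence 2C.
  refine ⟨D, 2 * C, by positivity, by positivity, fun x => ?_, fun t => ?_,
    fun t x y => ?_, fun t x => ?_, fun t x => ?_⟩
  · have h2 : Continuous fun t => bilin γ s (evol γ ν t (x : L2C)) (evol γ ν t (x : L2C)) :=
      (continuous_bilin_self hγ hs).comp (continuous_evol_apply hγ ν _)
    refine Continuous.subtype_mk ?_ _
    rw [← continuousOn_univ]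
    exact continuous_evol_comp hγ ν continuous_neg.continuousOn h2.continuousOn
  · apply Subtype.ext
    simp only [field, ZeroMemClass.coe_zero, map_zero, bilin_zero hγ hs]
  · rw [Submodule.coe_norm, Submodule.coe_norm, Submodule.coe_norm, Submodule.coe_norm,
      Submodule.coe_sub, Submodule.coe_sub]
    simp only [field]
    rw [← map_sub, norm_evol hγ, bilin_self_sub hγ hs, ← map_sub]
    refine (norm_add_le _ _).trans ((add_le_add (hb _ _) (hb _ _)).trans_eq ?_)
    rw [norm_evol hγ, norm_evol hγ, norm_evol hγ]
    ring
  · rw [Submodule.coe_norm, Submodule.coe_norm]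
    simp only [field, energyL, ContinuousLinearMap.comp_apply, Submodule.subtypeL_apply,
      ContinuousLinearMap.coe_restrictScalars']
    rw [norm_evol hγ]
    refine (hC _ _).trans_eq ?_
    rw [hcomm, norm_evol hγ, norm_evol hγ]
    ring
  · simp only [field, energyL, ContinuousLinearMap.comp_apply, Submodule.subtypeL_apply,
      ContinuousLinearMap.coe_restrictScalars']
    have h1 := inner_energyRatio_bilin_eq_zero hγ hs (evol_mem_hermitian hγ ν t x.2)
    rw [real_inner_eq_re_inner] at h1 ⊢
    rw [hcomm, ← inner_evol_left hγ, ← hcomm]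
    exact h1

end Group

/-! ### Fourier transforms of real functions and of products -/

section RealFunctions

lemma fourier_conj (f : ℝ → ℂ) (ξ : ℝ) : 𝓕 (fun x => star (f x)) ξ = star (𝓕 f (-ξ)) := by
  rw [Real.fourier_real_eq_integral_exp_smul, Real.fourier_real_eq_integral_exp_smul,
    RCLike.star_def, ← integral_conj]
  refine integral_congr_ae (.of_forall fun x => ?_)
  simp only [smul_eq_mul, map_mul, ← Complex.exp_conj, Complex.conj_ofReal,
    Complex.conj_I]
  congr 2
  push_cast
  ring

/-- Both sides are continuous in v, so Schwartz functions suffice, where the transform is an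
integral. -/
lemma fourierL2_conjL (v : L2C) : 𝓕 (conjL v) = conjL (reflL (𝓕 v)) := by
  refine DenseRange.induction_on (p := fun v : L2C => 𝓕 (conjL v) = conjL (reflL (𝓕 v)))
    (SchwartzMap.denseRange_toLpCLM (p := 2) ENNReal.ofNat_ne_top) v ?_ fun φ => ?_
  · refine isClosed_eq ?_ ?_
    · exact (Lp.fourierTransformₗᵢ ℝ ℂ).continuous.comp conjL.continuous
    · exact conjL.continuous.comp
        (reflL.continuous.comp (Lp.fourierTransformₗᵢ ℝ ℂ).continuous)
  · change 𝓕 (conjL (φ.toLp 2)) = conjL (reflL (𝓕 (φ.toLp 2)))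
    set ψ : 𝓢(ℝ, ℂ) := SchwartzMap.postcompCLM (𝕜 := ℝ) (Complex.conjCLE : ℂ →L[ℝ] ℂ) φ with hψ
    have h1 : conjL (φ.toLp 2) = ψ.toLp 2 := by
      ext1
      filter_upwards [conjL_coe (φ.toLp 2), φ.coeFn_toLp 2 volume, ψ.coeFn_toLp 2 volume]
        with x e1 e2 e3
      rw [e1, e2, e3]
      rfl
    rw [h1, SchwartzMap.toLp_fourier_eq, SchwartzMap.toLp_fourier_eq]
    ext1
    have h2 := (𝓕 φ).coeFn_toLp 2 volume
    filter_upwards [(𝓕 ψ).coeFn_toLp 2 volume, conjL_coe (reflL ((𝓕 φ).toLp 2)),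
      reflL_coe ((𝓕 φ).toLp 2),
      (Measure.measurePreserving_neg (volume : Measure ℝ)).quasiMeasurePreserving.ae_eq_comp h2]
      with ξ e1 e2 e3 e4
    simp only [Function.comp_apply] at e4
    rw [e1, e2, e3, e4, SchwartzMap.fourier_coe, SchwartzMap.fourier_coe, ← fourier_conj]
    rfl

lemma fourierL2_mem_hermitian (u : Lp ℝ 2 (volume : Measure ℝ)) : fourierL2 u ∈ hermitian := by
  set v : L2C := Complex.ofRealCLM.compLp u with hv
  have h1 : conjL v = v := by
    ext1
    filter_upwards [conjL_coe v, Complex.ofRealCLM.coeFn_compLp u] with x e1 e2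
    rw [e1, hv, e2]
    simp
  have h2 := fourierL2_conjL v
  rw [h1] at h2
  change reflL (𝓕 v) = conjL (𝓕 v)
  ext1
  have h3 := conjL_coe (reflL (𝓕 v))
  rw [← h2] at h3
  filter_upwards [h3, conjL_coe (𝓕 v)] with ξ e1 e2
  rw [e2, e1, star_star]

/-- Hermitian symmetry makes the inverse transform equal to its own conjugate, so passing to real
parts loses nothing. -/
lemma exists_fourierL2_eq {g : L2C} (hg : g ∈ hermitian) :
    ∃ u : Lp ℝ 2 (volume : Measure ℝ), fourierL2 u = g := by
  set v : L2C := 𝓕⁻ g with hv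
  have hFv : 𝓕 v = g := FourierTransform.fourier_fourierInv_eq g
  have h1 : conjL v = v := by
    have h2 : 𝓕 (conjL v) = 𝓕 v := by
      rw [fourierL2_conjL, hFv]
      have hg' : reflL g = conjL g := hg
      rw [hg']
      ext1
      filter_upwards [conjL_coe (conjL g), conjL_coe g] with ξ e1 e2
      rw [e1, e2, star_star]
    exact (Lp.fourierTransformₗᵢ ℝ ℂ).injective h2
  refine ⟨Complex.reCLM.compLp v, ?_⟩
  have h3 : (Complex.ofRealCLM.compLp (Complex.reCLM.compLp v) : L2C) = v := by
    ext1
    have h4 := conjL_coe v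
    rw [h1] at h4
    filter_upwards [Complex.ofRealCLM.coeFn_compLp (Complex.reCLM.compLp v),
      Complex.reCLM.coeFn_compLp v, h4] with x e1 e2 e3
    rw [e1, e2]
    exact Complex.conj_eq_iff_re.1 e3.symm
  rw [fourierL2, h3, hFv]

lemma inner_fourierL2 (p u : Lp ℝ 2 (volume : Measure ℝ)) :
    inner ℂ (fourierL2 p) (fourierL2 u) = ((∫ x, u x * p x : ℝ) : ℂ) := by
  rw [fourierL2, fourierL2, Lp.inner_fourier_eq, L2.inner_def, ← integral_complex_ofReal]
  refine integral_congr_ae ?_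
  filter_upwards [Complex.ofRealCLM.coeFn_compLp u, Complex.ofRealCLM.coeFn_compLp p] with x e1 e2
  rw [e1, e2]
  simp [RCLike.inner_apply, Complex.conj_ofReal]

lemma memLp_test {φ : ℝ → ℝ} (h : ContDiff ℝ ∞ φ) (hc : HasCompactSupport φ) (p : ℝ≥0∞) :
    MemLp φ p volume :=
  h.continuous.memLp_of_hasCompactSupport hc

/-- The Fourier transform of a test function, as an element of `L²`. -/
noncomputable def testHat {φ : ℝ → ℝ} (h : ContDiff ℝ ∞ φ) (hc : HasCompactSupport φ) : L2C :=
  fourierL2 ((memLp_test h hc 2).toLp φ)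

lemma inner_testHat {φ : ℝ → ℝ} (h : ContDiff ℝ ∞ φ) (hc : HasCompactSupport φ)
    (u : Lp ℝ 2 (volume : Measure ℝ)) :
    inner ℂ (testHat h hc) (fourierL2 u) = ((∫ x, u x * φ x : ℝ) : ℂ) := by
  rw [testHat, inner_fourierL2]
  congr 1
  refine integral_congr_ae ?_
  filter_upwards [(memLp_test h hc 2).coeFn_toLp] with x e
  rw [e]

lemma testHat_coe {φ : ℝ → ℝ} (h : ContDiff ℝ ∞ φ) (hc : HasCompactSupport φ) :
    testHat h hc =ᵐ[volume] 𝓕 (fun x => (φ x : ℂ)) := by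
  have hc' : HasCompactSupport fun x => (φ x : ℂ) := hc.comp_left Complex.ofReal_zero
  have h' : ContDiff ℝ ∞ fun x => (φ x : ℂ) := Complex.ofRealCLM.contDiff.comp h
  set ψ : 𝓢(ℝ, ℂ) := hc'.toSchwartzMap h' with hψ
  have h1 : (Complex.ofRealCLM.compLp ((memLp_test h hc 2).toLp φ) : L2C) = ψ.toLp 2 := by
    ext1
    filter_upwards [Complex.ofRealCLM.coeFn_compLp ((memLp_test h hc 2).toLp φ),
      (memLp_test h hc 2).coeFn_toLp, ψ.coeFn_toLp 2 volume] with x e1 e2 e3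
    rw [e1, e2, e3]
    rfl
  rw [testHat, fourierL2, h1, SchwartzMap.toLp_fourier_eq]
  exact (𝓕 ψ).coeFn_toLp 2 volume

lemma deriv_ofReal {φ : ℝ → ℝ} (h : Differentiable ℝ φ) :
    deriv (fun x => (φ x : ℂ)) = fun x => ((deriv φ x : ℝ) : ℂ) :=
  funext fun x => (h x).hasDerivAt.ofReal_comp.deriv

lemma iteratedDeriv_ofReal {φ : ℝ → ℝ} (h : ContDiff ℝ ∞ φ) (n : ℕ) :
    iteratedDeriv n (fun x => (φ x : ℂ)) = fun x => ((iteratedDeriv n φ x : ℝ) : ℂ) := by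
  induction n with
  | zero => simp
  | succ n ih =>
    rw [iteratedDeriv_succ, ih, iteratedDeriv_succ, deriv_ofReal]
    exact h.differentiable_iteratedDeriv n (by exact_mod_cast WithTop.coe_lt_top n)

lemma contDiff_iteratedDeriv {φ : ℝ → ℝ} (h : ContDiff ℝ ∞ φ) (n : ℕ) :
    ContDiff ℝ ∞ (iteratedDeriv n φ) := by
  induction n with
  | zero => simpa
  | succ n ih =>
    rw [iteratedDeriv_succ]
    exact (contDiff_infty_iff_deriv.1 ih).2

lemma hasCompactSupport_iteratedDeriv {φ : ℝ → ℝ} (hc : HasCompactSupport φ) (n : ℕ) :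
    HasCompactSupport (iteratedDeriv n φ) := by
  induction n with
  | zero => simpa
  | succ n ih =>
    rw [iteratedDeriv_succ]
    exact ih.deriv

lemma fourier_iteratedDeriv_ofReal {φ : ℝ → ℝ} (h : ContDiff ℝ ∞ φ) (hc : HasCompactSupport φ)
    (n : ℕ) (ξ : ℝ) : 𝓕 (fun x => ((iteratedDeriv n φ x : ℝ) : ℂ)) ξ =
      (Complex.I * (2 * Real.pi * ξ)) ^ n * 𝓕 (fun x => (φ x : ℂ)) ξ := by
  have h1 := Real.fourier_iteratedDeriv (N := ⊤) (n := n) (f := fun x => (φ x : ℂ))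
    (Complex.ofRealCLM.contDiff.comp h) (fun m _ => by
      rw [iteratedDeriv_ofReal h]
      exact Integrable.ofReal (memLp_one_iff_integrable.1 (memLp_test (contDiff_iteratedDeriv h m)
        (hasCompactSupport_iteratedDeriv hc m) 1))) le_top
  rw [iteratedDeriv_ofReal h] at h1
  rw [h1]
  change (2 * Real.pi * Complex.I * ξ : ℂ) ^ n * _ = _
  congr 2
  ring

/-- The multiplication formula (Fubini), taken with the pairing `-innerₗ ℝ`, whose Fourier integral
is the inverse transform. -/
lemma integral_fourierInv_mul {f g : ℝ → ℂ} (hf : Integrable f) (hg : Integrable g) :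
    ∫ x, 𝓕⁻ f x * g x = ∫ ξ, f ξ * 𝓕⁻ g ξ := by
  have := VectorFourier.integral_fourierIntegral_smul_eq_flip (e := Real.fourierChar)
    (L := -innerₗ ℝ) (μ := volume) (ν := volume) Real.continuous_fourierChar
    (by simp only [LinearMap.neg_apply, innerₗ_apply_apply]; fun_prop) hf hg
  have e : (-innerₗ ℝ : ℝ →ₗ[ℝ] ℝ →ₗ[ℝ] ℝ).flip = -innerₗ ℝ := by
    ext; simp
  rw [e] at this
  exact this

lemma fourierInv_ofReal {φ : ℝ → ℝ} (ξ : ℝ) :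
    𝓕⁻ (fun x => (φ x : ℂ)) ξ = star (𝓕 (fun x => (φ x : ℂ)) ξ) := by
  rw [Real.fourierInv_eq_fourier_neg]
  have := fourier_conj (fun x => (φ x : ℂ)) (-ξ)
  rw [neg_neg] at this
  rw [← this]
  simp only [RCLike.star_def, Complex.conj_ofReal]

/-- A real `L²` function with integrable Fourier transform is its inverse Fourier integral. -/
lemma ofReal_eq_fourierInv (u : Lp ℝ 2 (volume : Measure ℝ))
    (hu : Integrable (fourierL2 u)) : (fun x => (u x : ℂ)) =ᵐ[volume] 𝓕⁻ (fourierL2 u : ℝ → ℂ) := by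
  have hcont : Continuous (𝓕⁻ (fourierL2 u : ℝ → ℂ)) :=
    VectorFourier.fourierIntegral_continuous Real.continuous_fourierChar
      (by simp only [LinearMap.neg_apply, innerₗ_apply_apply]; fun_prop) hu
  have hloc : LocallyIntegrable (fun x => (u x : ℂ)) volume :=
    MemLp.locallyIntegrable (p := 2) (Lp.memLp u).ofReal (by norm_num)
  have h := ae_eq_of_integral_contDiff_smul_eq hloc hcont.locallyIntegrable fun g hg hgc => ?_
  · exact h
  have hgi : Integrable fun x => (g x : ℂ) :=
    Integrable.ofReal (memLp_one_iff_integrable.1 (memLp_test hg hgc 1))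
  have e1 := inner_testHat hg hgc u
  rw [L2.inner_def] at e1
  have e2 := integral_fourierInv_mul hu hgi
  calc ∫ x, g x • (u x : ℂ) = ((∫ x, u x * g x : ℝ) : ℂ) := by
        rw [← integral_complex_ofReal]
        refine integral_congr_ae (.of_forall fun x => ?_)
        simp [mul_comm]
    _ = ∫ ξ, fourierL2 u ξ * 𝓕⁻ (fun x => (g x : ℂ)) ξ := by
        rw [← e1]
        refine integral_congr_ae ?_
        filter_upwards [testHat_coe hg hgc] with ξ h
        rw [RCLike.inner_apply, h, fourierInv_ofReal]
        rfl
    _ = ∫ x, g x • 𝓕⁻ (fourierL2 u : ℝ → ℂ) x := by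
        rw [← e2]
        refine integral_congr_ae (.of_forall fun x => ?_)
        simp [mul_comm]

/-- For û in L¹, u agrees almost everywhere with an inverse Fourier integral, so u² is the inverse
transform of û * û. The multiplication formula then moves the transform onto φ. -/
lemma integral_sq_mul_test (u : Lp ℝ 2 (volume : Measure ℝ)) (hu : Integrable (fourierL2 u))
    {φ : ℝ → ℝ} (h : ContDiff ℝ ∞ φ) (hc : HasCompactSupport φ) :
    ((∫ x, u x ^ 2 * φ x : ℝ) : ℂ) =
      ∫ ξ, conv (fourierL2 u) (fourierL2 u) ξ * star (𝓕 (fun x => (φ x : ℂ)) ξ) := by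
  have hφi : Integrable fun x => (φ x : ℂ) :=
    Integrable.ofReal (memLp_one_iff_integrable.1 (memLp_test h hc 1))
  have hconv : Integrable (conv (fourierL2 u) (fourierL2 u)) :=
    hu.integrable_convolution (ContinuousLinearMap.mul ℂ ℂ) hu
  have e : ∀ x, 𝓕⁻ (conv (fourierL2 u) (fourierL2 u)) x = 𝓕⁻ (fourierL2 u : ℝ → ℂ) x ^ 2 := by
    intro x
    rw [Real.fourierInv_eq_fourier_neg, Real.fourierInv_eq_fourier_neg, sq]
    exact Real.fourier_mul_convolution_eq hu hu (-x)
  simp_rw [← fourierInv_ofReal]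
  rw [← integral_fourierInv_mul hconv hφi, ← integral_complex_ofReal]
  refine integral_congr_ae ?_
  filter_upwards [ofReal_eq_fourierInv u hu] with x hx
  rw [e, ← hx]
  push_cast
  rfl

end RealFunctions

/-! ### The weak equation on the Fourier side -/

section WeakForm

variable {γ ν s : ℝ}

/-- `w_s û` for `u ∈ H^s`. -/
noncomputable def wave (u : Sobolev s) : L2C := weightedFourierL2 s u

lemma wave_coe (u : Sobolev s) : wave u =ᵐ[volume] weightedFourier s u.toL2 :=
  MemLp.coeFn_toLp (show sobolevSubmodule s from u).2

lemma norm_eq_norm_wave (u : Sobolev s) : ‖u‖ = ‖wave u‖ := rfl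

lemma wave_sub (u v : Sobolev s) : wave (u - v) = wave u - wave v :=
  map_sub (weightedFourierL2 s) _ _

lemma dist_eq_norm_wave (u v : Sobolev s) : dist u v = ‖wave u - wave v‖ := by
  rw [dist_eq_norm, norm_eq_norm_wave, wave_sub]

lemma isometry_wave : Isometry (wave : Sobolev s → L2C) :=
  Isometry.of_dist_eq fun u v => by rw [dist_eq_norm_wave, dist_eq_norm]

lemma mulL_invWeight_wave (hs : 0 ≤ s) (u : Sobolev s) :
    mulL (invWeight s) (wave u) = fourierL2 u.toL2 := by
  ext1
  filter_upwards [mulL_coe (isMultiplier_invWeight hs) (wave u), wave_coe u] with ξ h1 h2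
  have hw : (sobolevWeight s ξ : ℂ) ≠ 0 := by exact_mod_cast (sobolevWeight_pos s ξ).ne'
  rw [h1, h2, weightedFourier, invWeight, Complex.ofReal_inv, inv_mul_cancel_left₀ hw]

lemma wave_mem_hermitian (u : Sobolev s) : wave u ∈ hermitian := by
  have h1 := mem_hermitian_iff.1 (fourierL2_mem_hermitian u.toL2)
  rw [mem_hermitian_iff]
  filter_upwards [h1, wave_coe u,
    (Measure.measurePreserving_neg (volume : Measure ℝ)).quasiMeasurePreserving.ae_eq_comp
      (wave_coe u)] with ξ e1 e2 e3
  simp only [Function.comp_apply] at e3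
  rw [e2, e3, weightedFourier, weightedFourier, e1, sobolevWeight_neg, star_mul', RCLike.star_def,
    Complex.conj_ofReal]

/-- Together with `wave_mem_hermitian` and `isometry_wave`, this identifies H^s with the Hermitian
functions, so curves there can be read back as curves in H^s. -/
lemma exists_wave_eq (hs : 0 ≤ s) {g : L2C} (hg : g ∈ hermitian) : ∃ u : Sobolev s, wave u = g := by
  have hI := isMultiplier_invWeight hs
  obtain ⟨v, hv⟩ := exists_fourierL2_eq (mulL_mem_hermitian hI (invWeight_neg s) hg)
  have h1 : weightedFourier s v =ᵐ[volume] g := by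
    filter_upwards [mulL_coe hI g] with ξ h
    have hw : (sobolevWeight s ξ : ℂ) ≠ 0 := by exact_mod_cast (sobolevWeight_pos s ξ).ne'
    rw [weightedFourier, hv, h, invWeight, Complex.ofReal_inv, mul_inv_cancel_left₀ hw]
  have h2 : v ∈ sobolevSubmodule s := (memLp_congr_ae h1).2 (Lp.memLp g)
  refine ⟨(⟨v, h2⟩ : sobolevSubmodule s), ?_⟩
  ext1
  exact (wave_coe _).trans h1

/-- The symbol `i λ / w_s`. -/
noncomputable def genSymbol (γ ν s ξ : ℝ) : ℂ := Complex.I * (phase γ ν ξ : ℂ) * invWeight s ξ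

/-- The derivative lost by the phase is paid for by 1/w_s: the generator is bounded from H^s to L².
-/
lemma norm_genSymbol_le (hγ : 0 < γ) (hs : 1 ≤ s) (ν ξ : ℝ) :
    ‖genSymbol γ ν s ξ‖ ≤ (1 + |ν| / γ) / √γ * √(1 + γ) := by
  have hw := sobolevWeight_pos s ξ
  rw [genSymbol, norm_mul, norm_mul, Complex.norm_I, one_mul, Complex.norm_real, Real.norm_eq_abs,
    invWeight, Complex.norm_real, Real.norm_eq_abs, abs_of_pos (inv_pos.2 hw), ← div_eq_mul_inv,
    div_le_iff₀ hw]
  refine (abs_phase_le hγ ν ξ).trans ?_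
  rw [mul_assoc]
  gcongr
  exact energyWeight_le_sobolevWeight hγ hs ξ

lemma isMultiplier_genSymbol (hγ : 0 < γ) (hs : 1 ≤ s) (ν : ℝ) :
    IsMultiplier (genSymbol γ ν s) := by
  refine ⟨?_, _, norm_genSymbol_le hγ hs ν⟩
  have h1 := (continuous_phase hγ ν).measurable
  have h2 := (isMultiplier_invWeight (s := s) (by linarith)).measurable
  unfold genSymbol
  fun_prop

/-- The time derivative of `û`, in terms of `g = w_s û`. -/
noncomputable def rhs (γ ν s : ℝ) (g : L2C) : L2C :=
  mulL (genSymbol γ ν s) g + mulL (invWeight s) (bilin γ s g g)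

lemma contDiff_test {χ : ℝ → ℝ} (h : ContDiff ℝ ∞ χ) (γ : ℝ) :
    ContDiff ℝ ∞ fun x => χ x - γ * iteratedDeriv 2 χ x :=
  h.sub (contDiff_const.mul (contDiff_iteratedDeriv h 2))

lemma hasCompactSupport_test {χ : ℝ → ℝ} (hc : HasCompactSupport χ) (γ : ℝ) :
    HasCompactSupport fun x => χ x - γ * iteratedDeriv 2 χ x :=
  hc.sub (hasCompactSupport_iteratedDeriv hc 2).mul_left

lemma fourier_add_const_mul {f g : ℝ → ℂ} (hf : Integrable f) (hg : Integrable g) (c : ℂ) (ξ : ℝ) :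
    𝓕 (fun x => f x + c * g x) ξ = 𝓕 f ξ + c * 𝓕 g ξ := by
  rw [Real.fourier_eq, Real.fourier_eq, Real.fourier_eq, ← integral_const_mul, ← integral_add]
  · refine integral_congr_ae (.of_forall fun x => ?_)
    simp only [Circle.smul_def, smul_eq_mul]
    ring
  · exact (Real.fourierIntegral_convergent_iff ξ).2 hf
  · exact ((Real.fourierIntegral_convergent_iff ξ).2 hg).const_mul c

lemma integrable_ofReal_test {φ : ℝ → ℝ} (h : ContDiff ℝ ∞ φ) (hc : HasCompactSupport φ) :
    Integrable fun x => (φ x : ℂ) :=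
  Integrable.ofReal (memLp_one_iff_integrable.1 (memLp_test h hc 1))

lemma fourier_test {χ : ℝ → ℝ} (h : ContDiff ℝ ∞ χ) (hc : HasCompactSupport χ) (γ ξ : ℝ) :
    𝓕 (fun x => ((χ x - γ * iteratedDeriv 2 χ x : ℝ) : ℂ)) ξ =
      (1 + γ * (2 * Real.pi * ξ) ^ 2) * 𝓕 (fun x => (χ x : ℂ)) ξ := by
  have h1 := fourier_add_const_mul (integrable_ofReal_test h hc) (integrable_ofReal_test
    (contDiff_iteratedDeriv h 2) (hasCompactSupport_iteratedDeriv hc 2)) (-γ) ξ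
  rw [fourier_iteratedDeriv_ofReal h hc, mul_pow Complex.I, Complex.I_sq] at h1
  have e : (fun x => ((χ x - γ * iteratedDeriv 2 χ x : ℝ) : ℂ)) =
      fun x => (χ x : ℂ) + -γ * ((iteratedDeriv 2 χ x : ℝ) : ℂ) := by
    ext x; push_cast; ring
  rw [e, h1]
  ring

lemma fourier_test_linear {χ : ℝ → ℝ} (h : ContDiff ℝ ∞ χ) (hc : HasCompactSupport χ) (ν ξ : ℝ) :
    𝓕 (fun x => ((deriv χ x + ν * iteratedDeriv 3 χ x : ℝ) : ℂ)) ξ =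
      (Complex.I * (2 * Real.pi * ξ) + ν * (Complex.I * (2 * Real.pi * ξ)) ^ 3) *
        𝓕 (fun x => (χ x : ℂ)) ξ := by
  have h1 := fourier_add_const_mul (integrable_ofReal_test (contDiff_iteratedDeriv h 1)
    (hasCompactSupport_iteratedDeriv hc 1)) (integrable_ofReal_test
    (contDiff_iteratedDeriv h 3) (hasCompactSupport_iteratedDeriv hc 3)) ν ξ
  rw [fourier_iteratedDeriv_ofReal h hc, fourier_iteratedDeriv_ofReal h hc, iteratedDeriv_one] at h1
  have e : (fun x => ((deriv χ x + ν * iteratedDeriv 3 χ x : ℝ) : ℂ)) =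
      fun x => ((deriv χ x : ℝ) : ℂ) + ν * ((iteratedDeriv 3 χ x : ℝ) : ℂ) := by
    ext x; push_cast; ring
  rw [e, h1]
  ring

/-- The element `(1 + γ κ²) χ̂` of `L²`, against which the equation is tested. -/
noncomputable def testPsi (γ : ℝ) {χ : ℝ → ℝ} (h : ContDiff ℝ ∞ χ) (hc : HasCompactSupport χ) :
    L2C :=
  testHat (contDiff_test h γ) (hasCompactSupport_test hc γ)

lemma testPsi_coe (γ : ℝ) {χ : ℝ → ℝ} (h : ContDiff ℝ ∞ χ) (hc : HasCompactSupport χ) :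
    testPsi γ h hc =ᵐ[volume] fun ξ =>
      (1 + γ * (2 * Real.pi * ξ) ^ 2) * 𝓕 (fun x => (χ x : ℂ)) ξ :=
  (testHat_coe _ _).trans (.of_forall fun ξ => fourier_test h hc γ ξ)

lemma inner_testPsi (hs : 0 ≤ s) (γ : ℝ) {χ : ℝ → ℝ} (h : ContDiff ℝ ∞ χ)
    (hc : HasCompactSupport χ) (u : Sobolev s) :
    inner ℂ (testPsi γ h hc) (mulL (invWeight s) (wave u)) =
      ((∫ x, u.toL2 x * (χ x - γ * iteratedDeriv 2 χ x) : ℝ) : ℂ) := by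
  rw [mulL_invWeight_wave hs, testPsi, inner_testHat]

/-- The factor 1 + γκ² of the test function cancels the denominator of the phase; conjugating the
symbol of ∂ₓ + ν∂ₓ³ accounts for the signs. -/
lemma inner_testPsi_gen (hγ : 0 < γ) (hs : 1 ≤ s) (ν : ℝ) {χ : ℝ → ℝ} (h : ContDiff ℝ ∞ χ)
    (hc : HasCompactSupport χ) (u : Sobolev s) :
    inner ℂ (testPsi γ h hc) (mulL (genSymbol γ ν s) (wave u)) =
      ((∫ x, u.toL2 x * (deriv χ x + ν * iteratedDeriv 3 χ x) : ℝ) : ℂ) := by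
  have h1 : ContDiff ℝ ∞ fun x => deriv χ x + ν * iteratedDeriv 3 χ x := by
    have := contDiff_iteratedDeriv h 1
    rw [iteratedDeriv_one] at this
    exact this.add (contDiff_const.mul (contDiff_iteratedDeriv h 3))
  have h2 : HasCompactSupport fun x => deriv χ x + ν * iteratedDeriv 3 χ x :=
    hc.deriv.add (hasCompactSupport_iteratedDeriv hc 3).mul_left
  have hI := isMultiplier_invWeight (s := s) (by linarith)
  rw [← inner_testHat h1 h2, ← mulL_invWeight_wave (by linarith), L2.inner_def, L2.inner_def]
  refine integral_congr_ae ?_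
  filter_upwards [testPsi_coe γ h hc, mulL_coe (isMultiplier_genSymbol hγ hs ν) (wave u),
    testHat_coe h1 h2, mulL_coe hI (wave u)] with ξ e1 e2 e3 e4
  have hne : (1 + γ * (2 * Real.pi * ξ) ^ 2 : ℂ) ≠ 0 := by
    have : (0 : ℝ) < 1 + γ * (2 * Real.pi * ξ) ^ 2 := by positivity
    exact_mod_cast this.ne'
  have hp : (1 + γ * (2 * Real.pi * ξ) ^ 2 : ℂ) * (phase γ ν ξ : ℂ) =
      -(2 * Real.pi * ξ) + ν * (2 * Real.pi * ξ) ^ 3 := by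
    rw [phase]
    push_cast
    rw [mul_div_cancel₀ _ hne]
  rw [e1, e2, e3, e4, fourier_test_linear h hc, RCLike.inner_apply, RCLike.inner_apply, genSymbol]
  simp only [map_mul, map_add, map_pow, map_one, map_ofNat, Complex.conj_ofReal, Complex.conj_I]
  calc _ = Complex.I * ((1 + γ * (2 * Real.pi * ξ) ^ 2 : ℂ) * (phase γ ν ξ : ℂ)) * invWeight s ξ *
        wave u ξ * (starRingEnd ℂ) (𝓕 (fun x => (χ x : ℂ)) ξ) := by ring
    _ = _ := by
      rw [hp]
      linear_combination (ν * (2 * Real.pi * ξ) ^ 3 * Complex.I * invWeight s ξ * wave u ξ *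
        (starRingEnd ℂ) (𝓕 (fun x => (χ x : ℂ)) ξ)) * Complex.I_sq

/-- The weights w_s cancel, and 1 + γκ² cancels the denominator of m. The minus sign in m is the
integration by parts that puts the derivative on χ. -/
lemma inner_testPsi_bilin (hγ : 0 < γ) (hs : 1 ≤ s) {χ : ℝ → ℝ} (h : ContDiff ℝ ∞ χ)
    (hc : HasCompactSupport χ) (u : Sobolev s) :
    inner ℂ (testPsi γ h hc) (mulL (invWeight s) (bilin γ s (wave u) (wave u))) =
      ((3 / 4 * ∫ x, u.toL2 x ^ 2 * deriv χ x : ℝ) : ℂ) := by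
  have hd : ContDiff ℝ ∞ (deriv χ) := by
    have := contDiff_iteratedDeriv h 1
    rwa [iteratedDeriv_one] at this
  have hI := isMultiplier_invWeight (s := s) (by linarith)
  have hint : Integrable (fourierL2 u.toL2) := by
    rw [← mulL_invWeight_wave (by linarith), ← memLp_one_iff_integrable]
    exact memLp_one_invWeight hγ hs _
  rw [Complex.ofReal_mul, integral_sq_mul_test _ hint hd hc.deriv, ← integral_const_mul,
    L2.inner_def]
  refine integral_congr_ae ?_
  filter_upwards [testPsi_coe γ h hc, mulL_coe hI (bilin γ s (wave u) (wave u)),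
    bilin_coe hγ hs (wave u) (wave u)] with ξ e1 e2 e3
  have hw : (sobolevWeight s ξ : ℂ) ≠ 0 := by exact_mod_cast (sobolevWeight_pos s ξ).ne'
  have hne : (1 + γ * (2 * Real.pi * ξ) ^ 2 : ℂ) ≠ 0 := by
    have : (0 : ℝ) < 1 + γ * (2 * Real.pi * ξ) ^ 2 := by positivity
    exact_mod_cast this.ne'
  have hm : (1 + γ * (2 * Real.pi * ξ) ^ 2 : ℂ) * nonlinSymbol γ ξ =
      -(3 / 4) * (Complex.I * (2 * Real.pi * ξ)) := by
    rw [nonlinSymbol, mul_div_cancel₀ _ hne]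
  have h1 := fourier_iteratedDeriv_ofReal h hc 1 ξ
  rw [iteratedDeriv_one, pow_one] at h1
  rw [e1, e2, e3, h1, RCLike.inner_apply, bilinFun, mulL_invWeight_wave (by linarith), invWeight,
    Complex.ofReal_inv, mul_assoc (sobolevWeight s ξ : ℂ), inv_mul_cancel_left₀ hw]
  simp only [RCLike.star_def, map_mul, map_add, map_pow, map_one, map_ofNat, Complex.conj_ofReal,
    Complex.conj_I]
  calc _ = ((1 + γ * (2 * Real.pi * ξ) ^ 2 : ℂ) * nonlinSymbol γ ξ) *
        (conv (fourierL2 u.toL2) (fourierL2 u.toL2) ξ *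
          (starRingEnd ℂ) (𝓕 (fun x => (χ x : ℂ)) ξ)) := by ring
    _ = _ := by
      rw [hm]
      push_cast
      ring

lemma inner_testPsi_rhs (hγ : 0 < γ) (hs : 1 ≤ s) (ν : ℝ) {χ : ℝ → ℝ} (h : ContDiff ℝ ∞ χ)
    (hc : HasCompactSupport χ) (u : Sobolev s) :
    inner ℂ (testPsi γ h hc) (rhs γ ν s (wave u)) =
      (((∫ x, u.toL2 x * (deriv χ x + ν * iteratedDeriv 3 χ x)) +
        3 / 4 * ∫ x, u.toL2 x ^ 2 * deriv χ x : ℝ) : ℂ) := by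
  rw [rhs, inner_add_right, inner_testPsi_gen hγ hs, inner_testPsi_bilin hγ hs, Complex.ofReal_add]

/-- The weak equation on the Fourier side. -/
lemma isSolutionOn_iff (hν : 0 < 1 / 6 - ν) (hs : 1 ≤ s) {I : Set ℝ} {u : ℝ → Sobolev s} :
    IsSolutionOn ν s I u ↔ ContinuousOn (fun t => wave (u t)) I ∧
      ∀ (χ : ℝ → ℝ) (h : ContDiff ℝ ∞ χ) (hc : HasCompactSupport χ), ∀ t ∈ I,
        HasDerivWithinAt
          (fun τ => inner ℂ (testPsi (1 / 6 - ν) h hc) (mulL (invWeight s) (wave (u τ))))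
          (inner ℂ (testPsi (1 / 6 - ν) h hc) (rhs (1 / 6 - ν) ν s (wave (u t)))) I t := by
  have key : ∀ (χ : ℝ → ℝ) (h : ContDiff ℝ ∞ χ) (hc : HasCompactSupport χ) (t : ℝ),
      HasDerivWithinAt
          (fun τ => inner ℂ (testPsi (1 / 6 - ν) h hc) (mulL (invWeight s) (wave (u τ))))
          (inner ℂ (testPsi (1 / 6 - ν) h hc) (rhs (1 / 6 - ν) ν s (wave (u t)))) I t ↔
      HasDerivWithinAt
        (fun τ => ∫ x, (u τ).toL2 x * (χ x - (1 / 6 - ν) * iteratedDeriv 2 χ x))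
        ((∫ x, (u t).toL2 x * (deriv χ x + ν * iteratedDeriv 3 χ x))
          + 3 / 4 * ∫ x, ((u t).toL2 x) ^ 2 * deriv χ x) I t := by
    intro χ h hc t
    rw [inner_testPsi_rhs hν hs]
    simp only [inner_testPsi (s := s) (by linarith)]
    -- The pairings are real numbers embedded in ℂ, so real parts recover the real derivative.
    refine ⟨fun H => ?_, fun H => H.ofReal_comp⟩
    have := Complex.reCLM.hasFDerivAt.comp_hasDerivWithinAt t H
    simpa [Function.comp_def] using this
  constructor
  · rintro ⟨h1, h2⟩
    exact ⟨isometry_wave.continuous.comp_continuousOn h1, fun χ h hc t ht =>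
      (key χ h hc t).2 (h2 χ h hc t ht)⟩
  · rintro ⟨h1, h2⟩
    exact ⟨isometry_wave.isEmbedding.continuousOn_iff.2 h1, fun χ h hc t ht =>
      (key χ h hc t).1 (h2 χ h hc t ht)⟩

end WeakForm

/-! ### Uniqueness of weak solutions -/

section Uniqueness

variable {γ ν s : ℝ}

/-- An integrable function with vanishing inverse Fourier transform is zero. -/
lemma ae_eq_zero_of_fourierInv_eq_zero {H : ℝ → ℂ} (hH : Integrable H) (h0 : ∀ x, 𝓕⁻ H x = 0) :
    H =ᵐ[volume] 0 := by
  refine ae_eq_zero_of_integral_contDiff_smul_eq_zero hH.locallyIntegrable fun g hg hgc => ?_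
  have hgc' : HasCompactSupport fun x => (g x : ℂ) := hgc.comp_left Complex.ofReal_zero
  set ψ : 𝓢(ℝ, ℂ) := hgc'.toSchwartzMap (Complex.ofRealCLM.contDiff.comp hg) with hψ
  have e1 : 𝓕⁻ ((𝓕 ψ : 𝓢(ℝ, ℂ)) : ℝ → ℂ) = ψ := by
    rw [← SchwartzMap.fourierInv_coe, FourierTransform.fourierInv_fourier_eq]
  have e2 := integral_fourierInv_mul hH (𝓕 ψ : 𝓢(ℝ, ℂ)).integrable
  simp only [h0, zero_mul, integral_zero] at e2
  rw [e1] at e2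
  rw [e2]
  refine integral_congr_ae (.of_forall fun x => ?_)
  change g x • H x = H x * (g x : ℂ)
  rw [Complex.real_smul, mul_comm]

lemma fourier_translate (f : ℝ → ℂ) (a ξ : ℝ) :
    𝓕 (fun x => f (x - a)) ξ = Complex.exp (((-2 * Real.pi * (a * ξ) : ℝ) : ℂ) * Complex.I) * 𝓕 f ξ := by
  rw [Real.fourier_real_eq_integral_exp_smul, Real.fourier_real_eq_integral_exp_smul,
    ← integral_const_mul,
    ← integral_sub_right_eq_self (fun x : ℝ => Complex.exp (((-2 * Real.pi * (a * ξ) : ℝ) : ℂ) * Complex.I) *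
      (Complex.exp ((-2 * Real.pi * x * ξ : ℝ) * Complex.I) • f x)) a]
  refine integral_congr_ae (.of_forall fun x => ?_)
  simp only [smul_eq_mul]
  rw [← mul_assoc, ← Complex.exp_add]
  congr 2
  push_cast
  ring

/-- A bump function whose Fourier transform does not vanish on `[-n, n]`. -/
lemma exists_test_fourier_ne_zero (n : ℕ) : ∃ χ : ℝ → ℝ, ContDiff ℝ ∞ χ ∧ HasCompactSupport χ ∧
    ∀ ξ : ℝ, |ξ| ≤ n → 𝓕 (fun x => (χ x : ℂ)) ξ ≠ 0 := by
  have hr : (0 : ℝ) < 1 / (8 * (n + 1)) := by positivity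
  -- For |x| below this radius and |ξ| ≤ n one has |2πxξ| ≤ π/4, so the cosine is positive on the
  -- support and the real part of the transform is positive.
  let χ : ContDiffBump (0 : ℝ) := ⟨1 / (8 * (n + 1)) / 2, 1 / (8 * (n + 1)), by positivity, by linarith⟩
  refine ⟨χ, χ.contDiff, χ.hasCompactSupport, fun ξ hξ h0 => ?_⟩
  have hint : Integrable fun x => (χ x : ℂ) :=
    integrable_ofReal_test χ.contDiff χ.hasCompactSupport
  have h1 : (𝓕 (fun x => (χ x : ℂ)) ξ).re = ∫ x, Real.cos (2 * Real.pi * x * ξ) * χ x := by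
    have h2 := (Real.fourierIntegral_convergent_iff ξ).2 hint
    rw [Real.fourier_real_eq_integral_exp_smul, ← RCLike.re_eq_complex_re, ← integral_re]
    · refine integral_congr_ae (.of_forall fun x => ?_)
      simp only [smul_eq_mul, RCLike.re_eq_complex_re, Complex.mul_re, Complex.ofReal_re,
        Complex.ofReal_im, mul_zero, sub_zero, Complex.exp_ofReal_mul_I_re]
      rw [← Real.cos_neg]
      congr 2
      ring
    · refine h2.congr (.of_forall fun x => ?_)
      simp only [Circle.smul_def, Real.fourierChar_apply, smul_eq_mul]
      congr 2
      simp only [RCLike.inner_apply, conj_trivial]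
      push_cast
      ring
  have hcos : ∀ x, χ x ≠ 0 → 0 < Real.cos (2 * Real.pi * x * ξ) := by
    intro x hx
    have hx' : |x| < 1 / (8 * (n + 1)) := by
      have : x ∈ Function.support χ := hx
      rwa [χ.support_eq, mem_ball_zero_iff, Real.norm_eq_abs] at this
    have h3 : |2 * Real.pi * x * ξ| < Real.pi / 2 := by
      rw [abs_mul, abs_mul, abs_mul, abs_two, abs_of_pos Real.pi_pos]
      have : |x| * |ξ| ≤ 1 / (8 * (n + 1)) * n := by gcongr
      have h4 : 1 / (8 * ((n : ℝ) + 1)) * n ≤ 1 / 8 := by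
        rw [div_mul_eq_mul_div, one_mul, div_le_div_iff₀ (by positivity) (by norm_num)]
        linarith
      have := Real.pi_pos
      calc 2 * Real.pi * |x| * |ξ| = 2 * Real.pi * (|x| * |ξ|) := by ring
        _ ≤ 2 * Real.pi * (1 / 8) := by gcongr; linarith
        _ < _ := by linarith
    exact Real.cos_pos_of_mem_Ioo ⟨by linarith [(abs_lt.1 h3).1], (abs_lt.1 h3).2⟩
  have hpos : 0 < ∫ x, Real.cos (2 * Real.pi * x * ξ) * χ x := by
    have hc : Continuous fun x => Real.cos (2 * Real.pi * x * ξ) * χ x :=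
      (by fun_prop : Continuous fun x => Real.cos (2 * Real.pi * x * ξ)).mul χ.continuous
    refine hc.integral_pos_of_hasCompactSupport_nonneg_nonzero χ.hasCompactSupport.mul_left
      (fun x => ?_) (x := 0) ?_
    · by_cases hx : χ x = 0
      · simp [hx]
      · exact mul_nonneg (hcos x hx).le χ.nonneg
    · have h5 : χ 0 = 1 := χ.one_of_mem_closedBall (by
        simp only [Metric.mem_closedBall, dist_self]
        exact χ.rIn_pos.le)
      simp [h5]
  rw [← h1, h0] at hpos
  simp at hpos

/-- Testing with all translates of one χ shows that E vanishes wherever χ̂ does not; countably many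
bumps then cover the line. -/
lemma eq_zero_of_inner_testPsi_eq_zero (hγ : 0 < γ) {E : L2C}
    (hE : ∀ (χ : ℝ → ℝ) (h : ContDiff ℝ ∞ χ) (hc : HasCompactSupport χ),
      inner ℂ (testPsi γ h hc) E = 0) : E = 0 := by
  have key : ∀ (χ : ℝ → ℝ) (_ : ContDiff ℝ ∞ χ) (_ : HasCompactSupport χ),
      ∀ᵐ ξ : ℝ, 𝓕 (fun x => (χ x : ℂ)) ξ ≠ 0 → E ξ = 0 := by
    intro χ h hc
    set H : ℝ → ℂ := fun ξ => inner ℂ (testPsi γ h hc ξ) (E ξ) with hH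
    have hHi : Integrable H := L2.integrable_inner _ _
    -- Translating χ by a multiplies its transform by exp(-2πi a ξ); conjugated by the inner
    -- product, this is the kernel of the inverse transform at a.
    have h0 : ∀ a, 𝓕⁻ H a = 0 := by
      intro a
      have h1 : ContDiff ℝ ∞ fun x => χ (x - a) := h.comp (contDiff_id.sub contDiff_const)
      have h2 : HasCompactSupport fun x => χ (x - a) :=
        hc.comp_homeomorph (Homeomorph.subRight a)
      have h3 := hE _ h1 h2
      rw [L2.inner_def] at h3
      rw [← h3, Real.fourierInv_eq]
      refine integral_congr_ae ?_
      filter_upwards [testPsi_coe γ h hc, testPsi_coe γ h1 h2] with ξ e1 e2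
      rw [hH, e2, fourier_translate (fun x => (χ x : ℂ)), RCLike.inner_apply]
      simp only [e1, RCLike.inner_apply, Circle.smul_def, Real.fourierChar_apply, smul_eq_mul,
        map_mul, ← Complex.exp_conj, Complex.conj_ofReal, Complex.conj_I]
      have e3 : Complex.exp (((2 * Real.pi * (a * (starRingEnd ℝ) ξ) : ℝ) : ℂ) * Complex.I) =
          Complex.exp (((-2 * Real.pi * (a * ξ) : ℝ) : ℂ) * -Complex.I) := by
        congr 1
        simp only [conj_trivial]
        push_cast
        ring
      rw [e3]
      ring
    filter_upwards [ae_eq_zero_of_fourierInv_eq_zero hHi h0, testPsi_coe γ h hc] with ξ e1 e2 e3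
    rw [hH, Pi.zero_apply] at e1
    simp only [e2, RCLike.inner_apply, mul_eq_zero] at e1
    rcases e1 with e1 | e1
    · exact e1
    · rw [map_eq_zero, mul_eq_zero] at e1
      rcases e1 with e1 | e1
      · exfalso
        have : (0 : ℝ) < 1 + γ * (2 * Real.pi * ξ) ^ 2 := by positivity
        exact this.ne' (by exact_mod_cast e1)
      · exact absurd e1 e3
  choose χ hχ hχc hχne using exists_test_fourier_ne_zero
  have hall := ae_all_iff.2 fun n => key (χ n) (hχ n) (hχc n)
  ext1
  filter_upwards [hall, Lp.coeFn_zero ℂ 2 (volume : Measure ℝ)] with ξ h1 h2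
  rw [h2, Pi.zero_apply]
  obtain ⟨n, hn⟩ := exists_nat_ge |ξ|
  exact h1 n (hχne n ξ hn)

lemma continuous_rhs (hγ : 0 < γ) (hs : 1 ≤ s) (ν : ℝ) : Continuous (rhs γ ν s) :=
  (mulL _).continuous.add ((mulL _).continuous.comp (continuous_bilin_self hγ hs))

/-- A weak solution satisfies the equation in `L²`. -/
lemma IsSolutionOn.hasDerivWithinAt (hν : 0 < 1 / 6 - ν) (hs : 1 ≤ s) {T : ℝ} (hT : 0 < T)
    {u : ℝ → Sobolev s} (hu : IsSolutionOn ν s (Icc 0 T) u) {t : ℝ} (ht : t ∈ Icc 0 T) :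
    HasDerivWithinAt (fun τ => mulL (invWeight s) (wave (u τ))) (rhs (1 / 6 - ν) ν s (wave (u t)))
      (Icc 0 T) t := by
  obtain ⟨hc, he⟩ := (isSolutionOn_iff hν hs).1 hu
  set V : ℝ → L2C := fun τ => mulL (invWeight s) (wave (u τ)) with hV
  set R : ℝ → L2C := fun τ => rhs (1 / 6 - ν) ν s (wave (u τ)) with hR
  have hRc : ContinuousOn R (Icc 0 T) := (continuous_rhs hν hs ν).comp_continuousOn hc
  -- Extended by constants, the right side is continuous on the whole line, so its primitive is
  -- differentiable at the end points too.
  set R' : ℝ → L2C := IccExtend hT.le ((Icc 0 T).domRestrict R) with hR'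
  have hR'c : Continuous R' := (continuousOn_iff_continuous_domRestrict.1 hRc).Icc_extend'
  have hRR' : ∀ τ ∈ Icc 0 T, R' τ = R τ := fun τ hτ => by
    rw [hR', IccExtend_of_mem hT.le _ hτ]
    rfl
  set P : ℝ → L2C := fun τ => ∫ r in (0 : ℝ)..τ, R' r with hP
  have hPd : ∀ τ, HasDerivAt P (R' τ) τ := fun τ =>
    intervalIntegral.integral_hasDerivAt_right (hR'c.intervalIntegrable _ _)
      hR'c.stronglyMeasurable.stronglyMeasurableAtFilter hR'c.continuousAt
  have hVc : ContinuousOn V (Icc 0 T) := (mulL _).continuous.comp_continuousOn hc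
  -- Each scalar pairing of the difference has zero derivative and starts at 0; the pairings
  -- separate points of L².
  have hVP : ∀ τ ∈ Icc 0 T, V τ = P τ + V 0 := by
    intro τ hτ
    rw [← sub_eq_zero]
    refine eq_zero_of_inner_testPsi_eq_zero hν fun χ h hχ => ?_
    have hd : ∀ r ∈ Icc 0 T, HasDerivWithinAt
        (fun r => inner ℂ (testPsi (1 / 6 - ν) h hχ) (V r - (P r + V 0))) 0 (Icc 0 T) r := by
      intro r hr
      have h1 := he χ h hχ r hr
      have h2 : HasDerivWithinAt (fun r => inner ℂ (testPsi (1 / 6 - ν) h hχ) (P r + V 0))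
          (inner ℂ (testPsi (1 / 6 - ν) h hχ) (R' r)) (Icc 0 T) r := by
        have h3 : HasDerivWithinAt (fun r => P r + V 0) (R' r) (Icc 0 T) r :=
          (hPd r).hasDerivWithinAt.add_const _
        exact ((innerSL ℂ (testPsi (1 / 6 - ν) h hχ)).restrictScalars ℝ).hasFDerivAt.comp_hasDerivWithinAt
          r h3
      have h4 := h1.sub h2
      rw [hRR' r hr, sub_self] at h4
      refine h4.congr (fun x _ => ?_) ?_ <;> exact inner_sub_right _ _ _
    have h5 := constant_of_has_deriv_right_zero (fun r hr => (hd r hr).continuousWithinAt)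
      (fun r hr => (hd r (Ico_subset_Icc_self hr)).Ici_of_Icc hr) τ hτ
    rw [h5]
    simp [hP]
  have h6 : HasDerivWithinAt (fun τ => P τ + V 0) (R' t) (Icc 0 T) t :=
    (hPd t).hasDerivWithinAt.add_const _
  rw [hRR' t ht] at h6
  exact h6.congr hVP (hVP t ht)

/-- The symbol iλ is purely imaginary, so the two vectors are pointwise orthogonal. -/
lemma inner_mulL_genSymbol (hγ : 0 < γ) (hs : 1 ≤ s) (ν : ℝ) (g : L2C) :
    inner ℝ (mulL (invWeight s) g) (mulL (genSymbol γ ν s) g) = 0 := by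
  rw [L2.inner_def]
  refine integral_eq_zero_of_ae ?_
  filter_upwards [mulL_coe (isMultiplier_invWeight (s := s) (by linarith)) g,
    mulL_coe (isMultiplier_genSymbol hγ hs ν) g] with ξ h1 h2
  have : mulL (genSymbol γ ν s) g ξ = Complex.I * (phase γ ν ξ : ℂ) * mulL (invWeight s) g ξ := by
    rw [h1, h2, genSymbol]; ring
  rw [this, Complex.inner]
  simp
  ring

/-- The linear term, which loses a derivative, drops out because it is skew. What remains is
bilinear and bounded with the difference measured in L² only. -/
lemma exists_inner_rhs_sub_le (hγ : 0 < γ) (hs : 1 ≤ s) (ν : ℝ) : ∃ C : ℝ, 0 ≤ C ∧ ∀ g h : L2C,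
    |inner ℝ (mulL (invWeight s) g - mulL (invWeight s) h) (rhs γ ν s g - rhs γ ν s h)| ≤
      C * (‖g‖ + ‖h‖) * ‖mulL (invWeight s) g - mulL (invWeight s) h‖ ^ 2 := by
  obtain ⟨C, hC0, hC⟩ := exists_norm_invWeight_bilin_le hγ hs
  refine ⟨C, hC0, fun g h => ?_⟩
  have e : rhs γ ν s g - rhs γ ν s h = mulL (genSymbol γ ν s) (g - h) +
      (mulL (invWeight s) (bilin γ s (g - h) g) + mulL (invWeight s) (bilin γ s (g - h) h)) := by
    rw [← map_add, ← bilin_self_sub hγ hs, rhs, rhs, map_sub, map_sub]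
    abel
  rw [e, ← map_sub, inner_add_right, inner_mulL_genSymbol hγ hs, zero_add]
  refine (abs_real_inner_le_norm _ _).trans ?_
  calc _ ≤ ‖mulL (invWeight s) (g - h)‖ * (C * ‖mulL (invWeight s) (g - h)‖ * ‖g‖ +
        C * ‖mulL (invWeight s) (g - h)‖ * ‖h‖) := by
        gcongr
        exact (norm_add_le _ _).trans (add_le_add (hC _ _) (hC _ _))
    _ = _ := by ring

lemma Sobolev.ext_fourier {u v : Sobolev s} (h : fourierL2 u.toL2 = fourierL2 v.toL2) : u = v := by
  have h1 : fourierL2 (u.toL2 + (-1 : ℝ) • v.toL2) = 0 := by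
    rw [fourierL2_add, fourierL2_smul, h]
    simp
  have h2 := fourierL2_eq_zero h1
  have h3 : u.toL2 = v.toL2 := by
    rwa [neg_one_smul, ← sub_eq_add_neg, sub_eq_zero] at h2
  exact Subtype.ext h3

/-- Grönwall for ‖û - v̂‖² in L², where û is differentiable. The H^s norms enter only as
coefficients, bounded by continuity on the compact interval. -/
theorem IsSolutionOn.eqOn (hν : 0 < 1 / 6 - ν) (hs : 1 ≤ s) {T : ℝ} (hT : 0 < T)
    {u v : ℝ → Sobolev s} (hu : IsSolutionOn ν s (Icc 0 T) u) (hv : IsSolutionOn ν s (Icc 0 T) v)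
    (h0 : u 0 = v 0) : EqOn u v (Icc 0 T) := by
  obtain ⟨C, hC0, hC⟩ := exists_inner_rhs_sub_le hν hs ν
  set Z : ℝ → L2C := fun t => mulL (invWeight s) (wave (u t)) - mulL (invWeight s) (wave (v t))
    with hZ
  have hZd : ∀ t ∈ Icc 0 T, HasDerivWithinAt Z
      (rhs (1 / 6 - ν) ν s (wave (u t)) - rhs (1 / 6 - ν) ν s (wave (v t))) (Icc 0 T) t :=
    fun t ht => (hu.hasDerivWithinAt hν hs hT ht).sub (hv.hasDerivWithinAt hν hs hT ht)
  have hN := fun t ht => (hZd t ht).norm_sq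
  obtain ⟨A, hA⟩ := isCompact_Icc.exists_bound_of_continuousOn hu.continuousOn
  obtain ⟨B, hB⟩ := isCompact_Icc.exists_bound_of_continuousOn hv.continuousOn
  have hzero := eq_zero_of_abs_deriv_le_mul_abs_self_of_eq_zero_right (f := fun t => ‖Z t‖ ^ 2)
    (K := 2 * (C * (A + B))) (fun t ht => (hN t ht).continuousWithinAt)
    (fun t ht => (hN t (Ico_subset_Icc_self ht)).Ici_of_Icc ht) (by simp [hZ, h0]) (by
      intro t ht
      have ht' := Ico_subset_Icc_self ht
      rw [Real.norm_eq_abs, abs_mul, abs_two, Real.norm_eq_abs,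
        abs_of_nonneg (sq_nonneg ‖Z t‖), mul_assoc]
      gcongr
      refine (hC _ _).trans ?_
      gcongr
      · exact hA t ht'
      · exact hB t ht')
  intro t ht
  have h1 : Z t = 0 := by
    have := hzero t ht
    simpa using this
  apply Sobolev.ext_fourier
  rw [← mulL_invWeight_wave (by linarith), ← mulL_invWeight_wave (by linarith)]
  exact sub_eq_zero.1 h1

end Uniqueness

/-! ### Existence, gluing and continuous dependence -/

section Existence

variable {γ ν s : ℝ}

/-- Taylor for |x| ≤ 1; for |x| > 1 the crude bound 2|x| is at most 2x². -/
lemma norm_exp_I_sub_one_sub_le (x : ℝ) :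
    ‖Complex.exp (Complex.I * x) - 1 - Complex.I * x‖ ≤ 2 * x ^ 2 := by
  have hn : ‖Complex.I * (x : ℂ)‖ = |x| := by simp
  by_cases hx : |x| ≤ 1
  · refine (Complex.norm_exp_sub_one_sub_id_le (by rwa [hn])).trans ?_
    rw [hn, sq_abs]
    nlinarith [sq_nonneg x]
  · have h1 := Real.norm_exp_I_mul_ofReal_sub_one_le (x := x)
    refine (norm_sub_le _ _).trans ?_
    rw [hn]
    rw [Real.norm_eq_abs] at h1
    push Not at hx
    nlinarith [sq_abs x]

/-- The Taylor remainder is at most 2h²λ², so it is O(h²) in L² once φ absorbs two powers of the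
phase; that is the role of C. -/
lemma hasDerivAt_evol_mulL (hγ : 0 < γ) (ν : ℝ) {φ : ℝ → ℂ} (hφ : IsMultiplier φ)
    (hφ' : IsMultiplier fun ξ => Complex.I * (phase γ ν ξ : ℂ) * φ ξ) {C : ℝ}
    (hC : ∀ ξ, phase γ ν ξ ^ 2 * ‖φ ξ‖ ≤ C) (f : L2C) (t : ℝ) :
    HasDerivAt (fun t => evol γ ν t (mulL φ f))
      (evol γ ν t (mulL (fun ξ => Complex.I * (phase γ ν ξ : ℂ) * φ ξ) f)) t := by
  rw [hasDerivAt_iff_isLittleO_nhds_zero]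
  have hb : ∀ h : ℝ, ‖evol γ ν (t + h) (mulL φ f) - evol γ ν t (mulL φ f) -
      h • evol γ ν t (mulL (fun ξ => Complex.I * (phase γ ν ξ : ℂ) * φ ξ) f)‖ ≤
        (2 * C * ‖f‖) * ‖h ^ 2‖ := by
    intro h
    have hle : ‖evol γ ν (t + h) (mulL φ f) - evol γ ν t (mulL φ f) -
      h • evol γ ν t (mulL (fun ξ => Complex.I * (phase γ ν ξ : ℂ) * φ ξ) f)‖ ≤
        (2 * C * h ^ 2) * ‖f‖ := by
      refine Lp.norm_le_mul_norm_of_ae_le_mul ?_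
      filter_upwards [Lp.coeFn_sub (evol γ ν (t + h) (mulL φ f) - evol γ ν t (mulL φ f))
          (h • evol γ ν t (mulL (fun ξ => Complex.I * (phase γ ν ξ : ℂ) * φ ξ) f)),
        Lp.coeFn_sub (evol γ ν (t + h) (mulL φ f)) (evol γ ν t (mulL φ f)),
        Lp.coeFn_smul h (evol γ ν t (mulL (fun ξ => Complex.I * (phase γ ν ξ : ℂ) * φ ξ) f)),
        evol_coe hγ ν (t + h) (mulL φ f), evol_coe hγ ν t (mulL φ f),
        evol_coe hγ ν t (mulL (fun ξ => Complex.I * (phase γ ν ξ : ℂ) * φ ξ) f),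
        mulL_coe hφ f, mulL_coe hφ' f] with ξ e1 e2 e3 e4 e5 e6 e7 e8
      have e : evolSymbol γ ν h ξ = Complex.exp (Complex.I * ((h * phase γ ν ξ : ℝ) : ℂ)) := rfl
      rw [e1, Pi.sub_apply, e2, Pi.sub_apply, e3, Pi.smul_apply, e4, e5, e6, e7, e8,
        evolSymbol_add, Complex.real_smul]
      have e9 : evolSymbol γ ν t ξ * evolSymbol γ ν h ξ * (φ ξ * f ξ) -
          evolSymbol γ ν t ξ * (φ ξ * f ξ) -
          h * (evolSymbol γ ν t ξ * (Complex.I * (phase γ ν ξ : ℂ) * φ ξ * f ξ)) =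
          evolSymbol γ ν t ξ * ((Complex.exp (Complex.I * ((h * phase γ ν ξ : ℝ) : ℂ)) - 1 -
            Complex.I * ((h * phase γ ν ξ : ℝ) : ℂ)) * (φ ξ * f ξ)) := by
        rw [e]; push_cast; ring
      rw [e9, norm_mul, norm_evolSymbol, one_mul, norm_mul, norm_mul]
      calc _ ≤ (2 * (h * phase γ ν ξ) ^ 2) * (‖φ ξ‖ * ‖f ξ‖) := by
            gcongr; exact norm_exp_I_sub_one_sub_le _
        _ = 2 * (phase γ ν ξ ^ 2 * ‖φ ξ‖) * h ^ 2 * ‖f ξ‖ := by ring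
        _ ≤ 2 * C * h ^ 2 * ‖f ξ‖ := by gcongr; exact hC ξ
    rw [Real.norm_eq_abs, abs_of_nonneg (sq_nonneg h)]
    linarith
  refine (Asymptotics.IsBigO.of_bound _ (.of_forall hb)).trans_isLittleO ?_
  exact Asymptotics.isLittleO_pow_id one_lt_two

/-- The multiplier `1 / (1 + γ κ²)`. -/
noncomputable def invEnergy (γ ξ : ℝ) : ℂ := ((1 + γ * (2 * Real.pi * ξ) ^ 2 : ℝ) : ℂ)⁻¹

lemma norm_invEnergy (hγ : 0 < γ) (ξ : ℝ) : ‖invEnergy γ ξ‖ = (energyWeight γ ξ ^ 2)⁻¹ := by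
  rw [invEnergy, norm_inv, Complex.norm_real, ← sq_energyWeight hγ, Real.norm_eq_abs,
    abs_of_nonneg (sq_nonneg _)]

lemma isMultiplier_invEnergy (hγ : 0 < γ) : IsMultiplier (invEnergy γ) := by
  refine ⟨by unfold invEnergy; fun_prop, 1, fun ξ => ?_⟩
  rw [norm_invEnergy hγ]
  exact inv_le_one_of_one_le₀ (one_le_pow₀ (one_le_energyWeight hγ ξ))

/-- Applying 1 - γ∂ₓ² once more to the smooth χ exhibits its test vector as 1/(1 + γκ²) times
another one. This supplies the decay that absorbs λ². -/
lemma testPsi_eq_mulL (hγ : 0 < γ) {χ : ℝ → ℝ} (h : ContDiff ℝ ∞ χ) (hc : HasCompactSupport χ) :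
    testPsi γ h hc = mulL (invEnergy γ)
      (testPsi γ (contDiff_test h γ) (hasCompactSupport_test hc γ)) := by
  ext1
  filter_upwards [mulL_coe (isMultiplier_invEnergy hγ)
      (testPsi γ (contDiff_test h γ) (hasCompactSupport_test hc γ)),
    testPsi_coe γ (contDiff_test h γ) (hasCompactSupport_test hc γ), testPsi_coe γ h hc]
    with ξ e1 e2 e3
  have hne : (1 + γ * (2 * Real.pi * ξ) ^ 2 : ℂ) ≠ 0 := by
    have : (0 : ℝ) < 1 + γ * (2 * Real.pi * ξ) ^ 2 := by positivity
    exact_mod_cast this.ne'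
  rw [e1, e2, e3, fourier_test h hc, invEnergy]
  push_cast
  rw [inv_mul_cancel_left₀ hne]

lemma hasDerivAt_evol_testPsi (hγ : 0 < γ) (hs : 1 ≤ s) (ν : ℝ) {χ : ℝ → ℝ} (h : ContDiff ℝ ∞ χ)
    (hc : HasCompactSupport χ) (t : ℝ) :
    HasDerivAt (fun t => evol γ ν t (mulL (invWeight s) (testPsi γ h hc)))
      (evol γ ν t (mulL (genSymbol γ ν s) (testPsi γ h hc))) t := by
  have hI := isMultiplier_invWeight (s := s) (by linarith)
  have hE := isMultiplier_invEnergy hγ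
  have hG := isMultiplier_genSymbol hγ hs ν
  have e : (fun ξ => Complex.I * (phase γ ν ξ : ℂ) * (invWeight s ξ * invEnergy γ ξ)) =
      fun ξ => genSymbol γ ν s ξ * invEnergy γ ξ := by
    ext ξ; rw [genSymbol]; ring
  -- λ² is at most this constant times e², and the multiplier contributes 1/e².
  have h1 := hasDerivAt_evol_mulL hγ ν (hI.mul hE) (by rw [e]; exact hG.mul hE)
    (C := ((1 + |ν| / γ) / √γ) ^ 2) (fun ξ => by
      have hw := one_le_sobolevWeight (s := s) (by linarith) ξ
      have he := energyWeight_pos hγ ξ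
      rw [norm_mul, norm_invEnergy hγ, invWeight, Complex.norm_real, Real.norm_eq_abs,
        abs_of_pos (inv_pos.2 (sobolevWeight_pos s ξ)), ← sq_abs]
      calc _ ≤ ((1 + |ν| / γ) / √γ * energyWeight γ ξ) ^ 2 * (1 * (energyWeight γ ξ ^ 2)⁻¹) := by
            gcongr
            · exact abs_phase_le hγ ν ξ
            · exact inv_le_one_of_one_le₀ hw
        _ = _ := by field_simp)
    (testPsi γ (contDiff_test h γ) (hasCompactSupport_test hc γ)) t
  have e2 := testPsi_eq_mulL hγ h hc
  rw [e, ← mulL_mulL hG hE, ← e2] at h1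
  simp only [← mulL_mulL hI hE, ← e2] at h1
  exact h1

/-- The group is only strongly continuous, so exp(itλ) a(t) is not differentiated directly. The
adjoint moves the group onto the test vector, where it is differentiable, and the product rule
yields the linear term from the test vector and the nonlinear one from a'. -/
lemma isSolutionOn_of_trajectory (hν : 0 < 1 / 6 - ν) (hs : 1 ≤ s) {I : Set ℝ}
    {a : ℝ → hermitian} (ha : ∀ t ∈ I, HasDerivWithinAt a (field hν hs ν t (a t)) I t)
    {u : ℝ → Sobolev s} (hu : ∀ t, wave (u t) = evol (1 / 6 - ν) ν t (a t)) :
    IsSolutionOn ν s I u := by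
  have hI := isMultiplier_invWeight (s := s) (by linarith)
  have hG := isMultiplier_genSymbol hν hs ν
  have ha' : ∀ t ∈ I, HasDerivWithinAt (fun t => (a t : L2C)) (field hν hs ν t (a t) : L2C) I t :=
    fun t ht => hermitian.subtypeL.hasFDerivAt.comp_hasDerivWithinAt t (ha t ht)
  have hIstar : (fun ξ => star (invWeight s ξ)) = invWeight s := by
    ext ξ; simp [invWeight, Complex.conj_ofReal]
  have hGstar : (fun ξ => star (genSymbol (1 / 6 - ν) ν s ξ)) =
      fun ξ => (-1 : ℂ) * genSymbol (1 / 6 - ν) ν s ξ := by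
    ext ξ
    simp only [genSymbol, invWeight, RCLike.star_def, map_mul, Complex.conj_ofReal, Complex.conj_I]
    ring
  have hone : IsMultiplier fun _ => (-1 : ℂ) := ⟨measurable_const, 1, fun _ => by simp⟩
  have hmneg : ∀ g : L2C, mulL (fun ξ => (-1 : ℂ) * genSymbol (1 / 6 - ν) ν s ξ) g =
      -mulL (genSymbol (1 / 6 - ν) ν s) g := by
    intro g
    ext1
    filter_upwards [mulL_coe (hone.mul hG) g, mulL_coe hG g,
      Lp.coeFn_neg (mulL (genSymbol (1 / 6 - ν) ν s) g)] with ξ e1 e2 e3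
    rw [e1, e3, Pi.neg_apply, e2]
    ring
  have hIl : ∀ f g : L2C, inner ℂ (mulL (invWeight s) f) g = inner ℂ f (mulL (invWeight s) g) :=
    fun f g => by
      have := inner_mulL_left hI (by rwa [hIstar]) f g
      rwa [hIstar] at this
  have hGl : ∀ f g : L2C, inner ℂ (mulL (genSymbol (1 / 6 - ν) ν s) f) g =
      -inner ℂ f (mulL (genSymbol (1 / 6 - ν) ν s) g) := fun f g => by
    have := inner_mulL_left hG (by rw [hGstar]; exact hone.mul hG) f g
    rwa [hGstar, hmneg, inner_neg_right] at this
  rw [isSolutionOn_iff hν hs]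
  refine ⟨?_, fun χ h hc t ht => ?_⟩
  · simp only [hu]
    exact continuous_evol_comp hν ν continuousOn_id fun t ht => (ha' t ht).continuousWithinAt
  · simp only [hu]
    have h1 : HasDerivAt (fun τ => evol (1 / 6 - ν) ν (-τ) (mulL (invWeight s) (testPsi (1 / 6 - ν) h hc)))
        (-evol (1 / 6 - ν) ν (-t) (mulL (genSymbol (1 / 6 - ν) ν s) (testPsi (1 / 6 - ν) h hc))) t := by
      have := (hasDerivAt_evol_testPsi hν hs ν h hc (-t)).scomp t (hasDerivAt_neg t)
      rwa [neg_one_smul] at this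
    have h2 := h1.hasDerivWithinAt.inner ℂ (ha' t ht)
    have e1 : ∀ τ, inner ℂ (evol (1 / 6 - ν) ν (-τ) (mulL (invWeight s) (testPsi (1 / 6 - ν) h hc)))
        (a τ : L2C) = inner ℂ (testPsi (1 / 6 - ν) h hc)
          (mulL (invWeight s) (evol (1 / 6 - ν) ν τ (a τ))) := fun τ => by
      rw [inner_evol_left hν, neg_neg, hIl]
    simp only [e1] at h2
    have e2 : inner ℂ (testPsi (1 / 6 - ν) h hc)
          (rhs (1 / 6 - ν) ν s (evol (1 / 6 - ν) ν t (a t))) =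
        inner ℂ (evol (1 / 6 - ν) ν (-t) (mulL (invWeight s) (testPsi (1 / 6 - ν) h hc)))
          (field hν hs ν t (a t) : L2C) +
        inner ℂ (-evol (1 / 6 - ν) ν (-t) (mulL (genSymbol (1 / 6 - ν) ν s)
          (testPsi (1 / 6 - ν) h hc))) (a t : L2C) := by
      rw [rhs, inner_add_right, inner_neg_left, inner_evol_left hν, inner_evol_left hν, neg_neg,
        hGl, neg_neg, hIl, field, evol_evol_neg hν, add_comm]
    rw [e2]
    exact h2

/-- The initial datum in the interaction picture. -/
noncomputable def datum (u₀ : Sobolev s) : hermitian := ⟨wave u₀, wave_mem_hermitian u₀⟩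

lemma norm_datum (u₀ : Sobolev s) : ‖datum u₀‖ = ‖u₀‖ := rfl

/-- A solution that comes from a trajectory of the equation in the interaction picture obeying the
a priori bound. -/
structure IsStrongSolution (hν : 0 < 1 / 6 - ν) (hs : 1 ≤ s) (C T : ℝ) (u₀ : Sobolev s)
    (u : ℝ → Sobolev s) (a : ℝ → hermitian) : Prop where
  initial : a 0 = datum u₀
  deriv : ∀ t ∈ Icc 0 T, HasDerivWithinAt a (field hν hs ν t (a t)) (Icc 0 T) t
  bound : ∀ t ∈ Icc 0 T, ‖a t‖ ≤ ‖u₀‖ * Real.exp (C * ‖u₀‖ * T)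
  wave_eq : ∀ t, wave (u t) = evol (1 / 6 - ν) ν t (a t)

lemma norm_energyL_le (hγ : 0 < γ) (hs : 1 ≤ s) (a : hermitian) :
    ‖energyL γ s a‖ ≤ √(1 + γ) * ‖a‖ :=
  norm_mulL_le (isMultiplier_energyRatio hγ hs) (norm_energyRatio_le hγ hs) (a : L2C)

lemma exists_isStrongSolution (hν : 0 < 1 / 6 - ν) (hs : 1 ≤ s) : ∃ C : ℝ, 0 ≤ C ∧
    ∀ T > 0, ∀ u₀ : Sobolev s, ∃ u a, IsStrongSolution hν hs C T u₀ u a := by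
  obtain ⟨K, C, hM⟩ := exists_tameField hν hs ν
  have hC := hM.nonneg_tame
  -- The square root bounds the energy norm of the datum by its H^s norm, so the a priori bound is
  -- uniform on balls of H^s.
  refine ⟨C * √(1 + (1 / 6 - ν)), by positivity, fun T hT u₀ => ?_⟩
  obtain ⟨a, ha0, ha⟩ := hM.exists_trajectory (datum u₀) hT
  choose u hu using fun t => exists_wave_eq (s := s) (by linarith) (evol_mem_hermitian hν ν t (a t).2)
  refine ⟨u, a, ha0, fun t ht => (ha t ht).1, fun t ht => (ha t ht).2.trans ?_, hu⟩
  rw [norm_datum]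
  gcongr ‖u₀‖ * Real.exp (?_ * T)
  rw [mul_assoc]
  exact mul_le_mul_of_nonneg_left (norm_energyL_le hν hs _) hC

variable {C T : ℝ} {u₀ : Sobolev s} {u : ℝ → Sobolev s} {a : ℝ → hermitian}

lemma IsStrongSolution.isSolutionOn {hν : 0 < 1 / 6 - ν} {hs : 1 ≤ s}
    (h : IsStrongSolution hν hs C T u₀ u a) : IsSolutionOn ν s (Icc 0 T) u :=
  isSolutionOn_of_trajectory hν hs h.deriv h.wave_eq

lemma IsStrongSolution.apply_zero {hν : 0 < 1 / 6 - ν} {hs : 1 ≤ s}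
    (h : IsStrongSolution hν hs C T u₀ u a) : u 0 = u₀ := by
  apply isometry_wave.injective
  rw [h.wave_eq, evol_zero hν, h.initial]
  rfl

lemma IsSolutionOn.mono {I J : Set ℝ} (h : IsSolutionOn ν s I u) (hJ : J ⊆ I) :
    IsSolutionOn ν s J u :=
  ⟨h.continuousOn.mono hJ, fun χ hχ hc t ht => (h.equation χ hχ hc t (hJ ht)).mono hJ⟩

lemma IsSolutionOn.congr {I : Set ℝ} {v : ℝ → Sobolev s} (h : IsSolutionOn ν s I u)
    (huv : EqOn v u I) : IsSolutionOn ν s I v := by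
  refine ⟨h.continuousOn.congr huv, fun χ hχ hc t ht => ?_⟩
  rw [huv ht]
  exact (h.equation χ hχ hc t ht).congr (fun τ hτ => by rw [huv hτ]) (by rw [huv ht])

/-- Continuity and one-sided derivatives are local: [0, t + 1] is a neighbourhood of t in the
half-line. -/
lemma isSolutionOn_Ici (h : ∀ T > 0, IsSolutionOn ν s (Icc 0 T) u) : IsSolutionOn ν s (Ici 0) u := by
  have hmem : ∀ t ∈ Ici (0 : ℝ), Icc 0 (t + 1) ∈ 𝓝[Ici 0] t := fun t _ =>
    mem_nhdsWithin.2 ⟨Iio (t + 1), isOpen_Iio, by simp, fun x hx => ⟨hx.2, le_of_lt hx.1⟩⟩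
  have hpos : ∀ t ∈ Ici (0 : ℝ), 0 < t + 1 := fun t ht => by
    have : (0 : ℝ) ≤ t := ht
    linarith
  refine ⟨fun t ht => ?_, fun χ hχ hc t ht => ?_⟩
  · exact ((h _ (hpos t ht)).continuousOn t ⟨ht, by linarith⟩).mono_of_mem_nhdsWithin (hmem t ht)
  · exact ((h _ (hpos t ht)).equation χ hχ hc t ⟨ht, by linarith⟩).mono_of_mem_nhdsWithin (hmem t ht)

/-- Uniqueness glues the solutions on bounded intervals. Continuous dependence is a Lipschitz bound
for trajectories, uniform on a ball of data. -/
theorem globallyWellPosed (hν : 0 < 1 / 6 - ν) (hs : 1 ≤ s) : GloballyWellPosed ν s := by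
  obtain ⟨C, hC0, hex⟩ := exists_isStrongSolution hν hs
  choose! w a hw using hex
  -- The value at t is read off a solution with a horizon beyond t; the added 1 keeps the horizon
  -- positive.
  set Φ : Sobolev s → ℝ → Sobolev s := fun u₀ t => w (max t 0 + 1) u₀ t with hΦ
  have hpos : ∀ t : ℝ, max t 0 + 1 > 0 := fun t => by positivity
  have hEq : ∀ u₀, ∀ T > 0, EqOn (Φ u₀) (w T u₀) (Icc 0 T) := by
    intro u₀ T hT t ht
    have h1 := hw _ (hpos t) u₀
    have h2 := hw T hT u₀
    -- Uniqueness is applied on [0, t], which needs t > 0; at t = 0 both sides are the datum.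
    rcases ht.1.eq_or_lt with h0 | h0
    · rw [← h0]
      simp only [hΦ]
      rw [(hw _ (hpos 0) u₀).apply_zero, h2.apply_zero]
    · have h3 : Icc 0 t ⊆ Icc 0 (max t 0 + 1) := by
        refine Icc_subset_Icc_right ?_
        have := le_max_left t 0
        linarith
      exact (h1.isSolutionOn.mono h3).eqOn hν hs h0
        (h2.isSolutionOn.mono (Icc_subset_Icc_right ht.2))
        (h1.apply_zero.trans h2.apply_zero.symm) ⟨ht.1, le_rfl⟩
  have hsol : ∀ u₀, ∀ T > 0, IsSolutionOn ν s (Icc 0 T) (Φ u₀) := fun u₀ T hT =>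
    (hw T hT u₀).isSolutionOn.congr (hEq u₀ T hT)
  have hzero : ∀ u₀, Φ u₀ 0 = u₀ := fun u₀ => (hw _ (hpos 0) u₀).apply_zero
  refine ⟨Φ, fun u₀ => ⟨isSolutionOn_Ici (hsol u₀), hzero u₀⟩, fun u₀ T hT v hv hv0 => ?_,
    fun u₀ T hT => ?_⟩
  · exact hv.eqOn hν hs hT (hsol u₀ T hT) (hv0.trans (hzero u₀).symm)
  · obtain ⟨K, C', hM⟩ := exists_tameField hν hs ν
    rw [Metric.tendstoUniformlyOn_iff]
    intro ε hε
    -- The a priori bound for every datum within distance 1 of u₀, so one Lipschitz constant serves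
    -- all of them.
    set R := (‖u₀‖ + 1) * Real.exp (C * (‖u₀‖ + 1) * T) with hR
    set L := Real.exp (2 * K * R * T) with hL
    have hL0 : 0 < L := Real.exp_pos _
    have hball : ∀ᶠ v₀ in 𝓝 u₀, dist v₀ u₀ < min 1 (ε / L) :=
      Metric.ball_mem_nhds u₀ (lt_min one_pos (by positivity))
    filter_upwards [hball] with v₀ hv₀ t ht
    have hv1 : ‖v₀‖ ≤ ‖u₀‖ + 1 := by
      have h1 : ‖v₀ - u₀‖ < 1 := by
        rw [← dist_eq_norm]; exact hv₀.trans_le (min_le_left _ _)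
      have h2 := norm_add_le u₀ (v₀ - u₀)
      rw [add_sub_cancel] at h2
      linarith
    have hbd : ∀ z₀ : Sobolev s, ‖z₀‖ ≤ ‖u₀‖ + 1 → ∀ t ∈ Icc 0 T, ‖a T z₀ t‖ ≤ R := by
      intro z₀ hz t ht
      refine ((hw T hT z₀).bound t ht).trans ?_
      rw [hR]
      gcongr
    have h3 := hM.norm_sub_le_of_trajectories (hw T hT u₀).deriv (hw T hT v₀).deriv
      (hbd u₀ (by linarith)) (hbd v₀ hv1) t ht
    -- At a fixed time both solutions are images of their trajectories under the same isometry, so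
    -- distances in H^s are distances of trajectories.
    rw [hEq u₀ T hT ht, hEq v₀ T hT ht, dist_eq_norm_wave, (hw T hT u₀).wave_eq,
      (hw T hT v₀).wave_eq, ← map_sub, norm_evol hν]
    have h4 : ‖a T u₀ 0 - a T v₀ 0‖ = dist v₀ u₀ := by
      rw [(hw T hT u₀).initial, (hw T hT v₀).initial, dist_comm, dist_eq_norm_wave]
      rfl
    rw [h4] at h3
    refine lt_of_le_of_lt h3 ?_
    have h5 : dist v₀ u₀ < ε / L := hv₀.trans_le (min_le_right _ _)
    exact (lt_div_iff₀ hL0).1 h5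

end Existence

end KdVBBM

theorem mainTheorem2 (ν s : ℝ) (hν : ν < 1 / 6) (hs : 1 ≤ s) :
    KdVBBM.GloballyWellPosed ν s :=
  KdVBBM.globallyWellPosed (by linarith) hs
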